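/- Let $B=(B_t)_{t\ge 0}$ be a standard Brownian motion on a probability space $(\Omega,\mathcal F,\mathbb P)$. For a process $X$ in $L^2(\mathbb P)$ let $H_t(X)$ be the closed linear span of $\{X_s : s\le t\}$ in $L^2(\mathbb P)$. Let $n<\infty$ and let $\lambda_1,\dots,\lambda_n$ be distinct real numbers with $\lambda_j>-1/2$ for all $j$. Put $$a_{j,n}=\frac{\prod_{l=1}^n(\lambda_j+\lambda_l+1)}{\prod_{l=1,\,l\ne j}^n(\lambda_j-\lambda_l)},\qquad K_n(x)=\sum_{j=1}^n a_{j,n}x^{\lambda_j},\qquad k_n(t,s)=\begin{cases}t^{-1}K_n(s/t)& s\le t,\\ 0&\text{otherwise,}\end{cases}$$ for $t,s>0$, and let $G_t(\lambda_1,\dots,\lambda_n;B)=\mathrm{Span}\{\int_0^t s^{\lambda_j}\,dB_s : j=1,\dots,n\}$ (Wiener integrals). A *Volterra kernel* is a function $l$ on $(0,\infty)^2$ with $l(s,v)=0$ for $s<v$, such that the symmetrized kernel, equal to $l(t,s)$ for $s\le t$ and to $l(s,t)$ for $s\ge t$, is continuous on $(0,\infty)^2$, and such that $l(u,\cdot)\in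 L^2[0,u]$ for all $u>0$ and $\int_0^t\big(\int_0^u l(u,v)^2\,dv\big)^{1/2}du<\infty$ for all $t>0$. Its *Volterra transform* is the continuous process, unique up to indistinguishability, $$T(B)_t=B_t-\int_0^t ds\int_0^s l(s,v)\,dB_v,\qquad t\ge 0,$$ where a jointly measurable version of the inner Wiener integrals is used. The kernel $l$ and the transform $T$ are called *Goursat–Volterra of order $n$* if $T(B)$ is a Brownian motion and there are $n$ linearly independent functions $g_1,\dots,g_n$ on $(0,\infty)$, square integrable on $(0,t]$ for every $t>0$ (functions equal a.e. being identified), such that for all $t>0$ there is the orthogonal decomposition $H_t(B)=H_t(T(B))\oplus\mathrm{Span}\{\int_0^t g_j(s)\,dB_s : j=1,\dots,n\}$. **Theorem.** The kernel $k_n$ is a Goursat–Volterra kernel of order $n$; in particular its Volterra transform $T_n(B)$ exists and is a Brownian motion. For every $t\ge0$, $H_t(T_n(B))\subseteq H_t(B)$, and the orthogonal complement of $H_t(T_n(B))$ in $H_t(B)$ is $G_t(\lambda_1,\dots,\lambda_n;B)$. Moreover, with $$\rho_n(x)=1-\int_1^x K_n(1/r)\,\frac{dr}{r},\qquad x\ge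 1,$$ the function $\rho_n$ is measurable with $\int_0^1\rho_n(1/v)^2\,dv<\infty$, and $T_n(B)_t=\int_0^t\rho_n(t/s)\,dB_s$ almost surely for every $t\ge 0$. -/

import Mathlib

open MeasureTheory ProbabilityTheory Filter Set
open scoped NNReal ENNReal Topology InnerProductSpace

noncomputable section

namespace MuntzBM

/-! ### Wiener integrals -/

/-- A step function `∑ i, c i • 1_{(a i, b i]}` on `(0, t]`. -/
structure StepFun (t : ℝ≥0) where
  m : ℕ
  c : Fin m → ℝ
  a : Fin m → ℝ≥0
  b : Fin m → ℝ≥0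
  a_le_b : ∀ i, a i ≤ b i
  b_le : ∀ i, b i ≤ t

/-- The values of a step function. -/
def StepFun.eval {t : ℝ≥0} (φ : StepFun t) (s : ℝ) : ℝ :=
  ∑ i, φ.c i * (Ioc (φ.a i : ℝ) (φ.b i : ℝ)).indicator (fun _ => (1 : ℝ)) s

/-- The elementary stochastic integral `∫_0^t φ dX = ∑ i, c i (X_{b i} - X_{a i})`. -/
def StepFun.integral {Ω : Type*} {t : ℝ≥0} (φ : StepFun t) (X : ℝ≥0 → Ω → ℝ) (ω : Ω) : ℝ :=
  ∑ i, φ.c i * (X (φ.b i) ω - X (φ.a i) ω)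

/-- `f ∈ L²[0,t]`. -/
def MemL2 (t : ℝ≥0) (f : ℝ → ℝ) : Prop :=
  MemLp f 2 (volume.restrict (Ioc (0 : ℝ) t))

/-- `Z` is (a version of) the Wiener integral `∫_0^t f(s) dX_s` of `f ∈ L²[0,t]`: the
`L²(P)`-limit of the elementary integrals of step functions converging to `f` in `L²[0,t]`. -/
def IsWienerIntegral {Ω : Type*} [MeasurableSpace Ω] (P : Measure Ω) (X : ℝ≥0 → Ω → ℝ)
    (t : ℝ≥0) (f : ℝ → ℝ) (Z : Ω → ℝ) : Prop :=
  MemL2 t f ∧ MemLp Z 2 P ∧ ∃ φ : ℕ → StepFun t,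
    Tendsto (fun k => eLpNorm (fun s => f s - (φ k).eval s) 2
      (volume.restrict (Ioc (0 : ℝ) t))) atTop (𝓝 0) ∧
    Tendsto (fun k => eLpNorm (fun ω => Z ω - (φ k).integral X ω) 2 P) atTop (𝓝 0)

/-! ### Gaussian spaces, as subspaces of `L²(P)` -/

/-- `H_t(X)`: the closed linear span of `{X_s, s ≤ t}` in `L²(P)`. -/
def gaussianSpace {Ω : Type*} [MeasurableSpace Ω] (P : Measure Ω) (X : ℝ≥0 → Ω → ℝ)
    (t : ℝ≥0) : Submodule ℝ (Lp ℝ 2 P) :=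
  (Submodule.span ℝ {Z : Lp ℝ 2 P | ∃ s ≤ t, Z =ᵐ[P] X s}).topologicalClosure

/-- `Span {∫_0^t g_j(s) dX_s, j = 1, …, n}` in `L²(P)`. -/
def wienerSpan {Ω : Type*} [MeasurableSpace Ω] (P : Measure Ω) (X : ℝ≥0 → Ω → ℝ)
    {n : ℕ} (g : Fin n → ℝ → ℝ) (t : ℝ≥0) : Submodule ℝ (Lp ℝ 2 P) :=
  Submodule.span ℝ {Z : Lp ℝ 2 P | ∃ j, IsWienerIntegral P X t (g j) Z}

/-- The Müntz Gaussian space `G_t(λ_1, …, λ_n; X)`. -/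
def muntzGaussianSpace {Ω : Type*} [MeasurableSpace Ω] (P : Measure Ω) (X : ℝ≥0 → Ω → ℝ)
    {n : ℕ} (lam : Fin n → ℝ) (t : ℝ≥0) : Submodule ℝ (Lp ℝ 2 P) :=
  wienerSpan P X (fun j s => s ^ lam j) t

/-- Orthogonal decomposition `H = K ⊕ G`. -/
def IsOrthogonalSum {E : Type*} [NormedAddCommGroup E] [InnerProductSpace ℝ E]
    (H K G : Submodule ℝ E) : Prop :=
  Submodule.IsOrtho K G ∧ K ⊔ G = H

/-! ### Volterra transforms -/

/-- Volterra kernels `l` on `ℝ_+² = (0,∞)²`: `l(s,v) = 0` for `s < v`, the symmetrized kernel is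
continuous, and `∫_0^t (∫_0^u l(u,v)² dv)^{1/2} du < ∞` for all `t`. -/
structure IsVolterraKernel (l : ℝ → ℝ → ℝ) : Prop where
  eq_zero : ∀ s v, 0 < s → s < v → l s v = 0
  continuousOn_symm : ContinuousOn
    (fun p : ℝ × ℝ => if p.2 ≤ p.1 then l p.1 p.2 else l p.2 p.1) (Ioi 0 ×ˢ Ioi 0)
  memL2 : ∀ u : ℝ≥0, 0 < u → MemL2 u (l u)
  integrable : ∀ t : ℝ≥0,
    IntegrableOn (fun u : ℝ => √(∫ v in (0 : ℝ)..u, l u v ^ 2)) (Ioc (0 : ℝ) t)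

/-- `T` is the (continuous version of the) Volterra transform
`T_t = B_t - ∫_0^t ds ∫_0^s l(s,v) dB_v`, where `Y` is a measurable process such that `Y_s` is a
version of the Wiener integral `∫_0^s l(s,v) dB_v` for every `s > 0`, and the outer integral is
the pathwise Lebesgue integral. -/
def IsVolterraTransform {Ω : Type*} [MeasurableSpace Ω] (P : Measure Ω) (B : ℝ≥0 → Ω → ℝ)
    (l : ℝ → ℝ → ℝ) (T : ℝ≥0 → Ω → ℝ) : Prop :=
  ∃ Y : ℝ → Ω → ℝ, Measurable (Function.uncurry Y) ∧
    (∀ s : ℝ≥0, 0 < s → IsWienerIntegral P B s (l s) (Y s)) ∧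
    ∀ᵐ ω ∂P, ∀ t : ℝ≥0, IntervalIntegrable (fun s => Y s ω) volume 0 t ∧
      T t ω = B t ω - ∫ s in (0 : ℝ)..t, Y s ω

/-- Linear independence in `L²_loc(ℝ_+)`, where functions that agree a.e. are identified. -/
def LinIndepAE {n : ℕ} (g : Fin n → ℝ → ℝ) : Prop :=
  ∀ c : Fin n → ℝ, (∀ᵐ x ∂(volume.restrict (Ioi (0 : ℝ))), ∑ j, c j * g j x = 0) → c = 0

/-- The process `T` (a transform of `B`) is a Brownian motion and there are `n` linearly
independent `g_j ∈ L²_loc(ℝ_+)` with `H_t(B) = H_t(T) ⊕ Span {∫_0^t g_j dB}` for all `t > 0`. -/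
def HasGoursatProperty {Ω : Type*} [MeasurableSpace Ω] (P : Measure Ω) (B : ℝ≥0 → Ω → ℝ)
    (n : ℕ) (T : ℝ≥0 → Ω → ℝ) : Prop :=
  IsBrownianReal T P ∧
    ∃ g : Fin n → ℝ → ℝ, (∀ j, ∀ t : ℝ≥0, MemL2 t (g j)) ∧ LinIndepAE g ∧
      ∀ t : ℝ≥0, 0 < t →
        IsOrthogonalSum (gaussianSpace P B t) (gaussianSpace P T t) (wienerSpan P B g t)

/-- `l` is a Goursat–Volterra kernel of order `n` (for the Brownian motion `B`): it is a Volterra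
kernel, its Volterra transform exists, and the transform (unique up to indistinguishability)
is a Goursat–Volterra transform of order `n`. -/
structure IsGoursatVolterraKernel {Ω : Type*} [MeasurableSpace Ω] (P : Measure Ω)
    (B : ℝ≥0 → Ω → ℝ) (n : ℕ) (l : ℝ → ℝ → ℝ) : Prop where
  volterra : IsVolterraKernel l
  exists_transform : ∃ T, IsVolterraTransform P B l T
  goursat : ∀ T, IsVolterraTransform P B l T → HasGoursatProperty P B n T

/-- The class `𝓜` of measurable `ρ : [1,∞) → ℝ` with `∫_0^1 ρ(1/v)² dv < ∞`. -/
def MemClassM (ρ : ℝ → ℝ) : Prop :=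
  Measurable ((Ici (1 : ℝ)).domRestrict ρ) ∧
    IntegrableOn (fun v : ℝ => ρ (1 / v) ^ 2) (Ioc (0 : ℝ) 1)

/-! ### The Müntz kernel -/

/-- `a_{j,n} = ∏_l (λ_j + λ_l + 1) / ∏_{l ≠ j} (λ_j - λ_l)`. -/
def muntzCoeff {n : ℕ} (lam : Fin n → ℝ) (j : Fin n) : ℝ :=
  (∏ l, (lam j + lam l + 1)) / ∏ l ∈ Finset.univ.erase j, (lam j - lam l)

/-- `K_n(s) = ∑_j a_{j,n} s^{λ_j}`. -/
def muntzK {n : ℕ} (lam : Fin n → ℝ) (s : ℝ) : ℝ :=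
  ∑ j, muntzCoeff lam j * s ^ lam j

/-- `k_n(t,s) = t⁻¹ K_n(s/t)` for `s ≤ t`, and `0` otherwise. -/
def muntzKernel {n : ℕ} (lam : Fin n → ℝ) (t s : ℝ) : ℝ :=
  if s ≤ t then t⁻¹ * muntzK lam (s / t) else 0

/-- `ρ_n(x) = 1 - ∫_1^x K_n(1/r) dr/r`. -/
def muntzRho {n : ℕ} (lam : Fin n → ℝ) (x : ℝ) : ℝ :=
  1 - ∫ r in (1 : ℝ)..x, muntzK lam (1 / r) / r

end MuntzBM

end

namespace MuntzBM

/-! ### Integrals of curves in `L²` -/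

section MinkowskiIntegral

variable {S X : Type*} [MeasurableSpace S] [MeasurableSpace X] {σ : Measure S} {ν : Measure X}

/-! The Wiener integral is an isometry `W` of L²(0,∞) into L²(P) with W(1_{(0,s]}) = B_s, so the
theorem can be pulled back to L²(0,∞). Exchanging `W` with the ds-integral (stochastic Fubini,
`isometry_integral_ae_eq`) gives T_t = W(x_t), where x_t = 1_{(0,t]} - ∫_0^t k_n(s,·) ds is
`transformL2`; computing this integral identifies x_t with ρ_n(t/·) on (0,t].

The algebraic core is ∑_i a_i/(λ_i+λ_j+1) = 1 (`sum_muntzCoeff_div`). It says that k_n(s,·)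
represents evaluation at the endpoint s on the span of the powers v^{λ_i} in L²(0,s]: ⟨v^{λ_i},
k_n(s,·)⟩ = s^{λ_i}. Integrating in s shows that the powers truncated to (0,t] are orthogonal to x_s
for s ≤ t. Applying it to the kernel itself gives ⟨k_n(t,·), k_n(s,·)⟩ = k_n(t,s) for s ≤ t, and
then ⟨x_s, x_t⟩ = s (`inner_transformL2`). The range of `W` is a Gaussian space, so T is a Brownian
motion.

Conversely, let x in L²(0,t] be orthogonal to all x_s, s ≤ t. Differentiating in s gives x(u) = ⟨x,
k_n(u,·)⟩ for almost every u, which is a linear system of Euler type for the moments J_j(u) = ∫_0^u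
v^{λ_j} x(v) dv. The inverse of the Cauchy matrix (1/(λ_i+λ_j+1)) diagonalizes it
(`exists_inverse_cauchy`), and x must be a combination of the powers (`exists_eq_sum_rpow`). Hence
the complement is exactly the Müntz space. -/

theorem lintegral_enorm_mul_le_eLpNorm {f g : X → ℝ} (hf : AEMeasurable f ν)
    (hg : AEMeasurable g ν) :
    ∫⁻ x, ‖f x‖ₑ * ‖g x‖ₑ ∂ν ≤ eLpNorm f 2 ν * eLpNorm g 2 ν := by
  have h := ENNReal.lintegral_mul_le_Lp_mul_Lq ν Real.HolderConjugate.two_two hf.enorm hg.enorm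
  rw [eLpNorm_eq_lintegral_rpow_enorm_toReal two_ne_zero ENNReal.ofNat_ne_top,
    eLpNorm_eq_lintegral_rpow_enorm_toReal two_ne_zero ENNReal.ofNat_ne_top]
  simpa using h

variable [SFinite ν] {F : S → X → ℝ}

theorem integrable_prod_mul_of_lintegral_eLpNorm (hF : Measurable (Function.uncurry F))
    (hfin : ∫⁻ s, eLpNorm (F s) 2 ν ∂σ ≠ ∞) {g : X → ℝ} (hg : MemLp g 2 ν) :
    Integrable (fun p : S × X => g p.2 * F p.1 p.2) (σ.prod ν) := by
  have hgm : AEStronglyMeasurable (fun p : S × X => g p.2) (σ.prod ν) := hg.1.comp_snd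
  have hsm : AEStronglyMeasurable (fun p : S × X => g p.2 * F p.1 p.2) (σ.prod ν) :=
    hgm.mul (hF.aestronglyMeasurable (f := fun p : S × X => F p.1 p.2))
  refine ⟨hsm, ?_⟩
  rw [HasFiniteIntegral, lintegral_prod _ hsm.enorm]
  refine lt_of_le_of_lt (b := ∫⁻ s, eLpNorm g 2 ν * eLpNorm (F s) 2 ν ∂σ) ?_ ?_
  · refine lintegral_mono fun s => ?_
    simp only [enorm_mul]
    exact lintegral_enorm_mul_le_eLpNorm hg.1.aemeasurable
      hF.of_uncurry_left.aemeasurable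
  · rw [lintegral_const_mul' _ _ hg.2.ne]
    exact ENNReal.mul_lt_top hg.2 hfin.lt_top

theorem integrable_integral_mul_of_lintegral_eLpNorm (hF : Measurable (Function.uncurry F))
    (hfin : ∫⁻ s, eLpNorm (F s) 2 ν ∂σ ≠ ∞) {g : X → ℝ} (hg : MemLp g 2 ν) :
    Integrable (fun s => ∫ x, g x * F s x ∂ν) σ :=
  (integrable_prod_mul_of_lintegral_eLpNorm hF hfin hg).integral_prod_left

variable [SFinite σ]

/-- Minkowski's integral inequality in L²: expand the square as a double integral over s and r, move
the integral over x inside by Tonelli, and apply Cauchy–Schwarz there. -/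
theorem lintegral_sq_lintegral_enorm_le (hF : Measurable (Function.uncurry F)) :
    ∫⁻ x, (∫⁻ s, ‖F s x‖ₑ ∂σ) ^ 2 ∂ν ≤ (∫⁻ s, eLpNorm (F s) 2 ν ∂σ) ^ 2 := by
  have hm : Measurable fun p : S × X => ‖F p.1 p.2‖ₑ := hF.enorm
  have hs (s : S) : Measurable (F s) := hF.of_uncurry_left
  calc ∫⁻ x, (∫⁻ s, ‖F s x‖ₑ ∂σ) ^ 2 ∂ν
      = ∫⁻ x, ∫⁻ s, ∫⁻ r, ‖F s x‖ₑ * ‖F r x‖ₑ ∂σ ∂σ ∂ν := by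
        refine lintegral_congr fun x => ?_
        have h1 : Measurable fun s => ‖F s x‖ₑ := hm.comp measurable_prodMk_right
        simp_rw [lintegral_const_mul _ h1]
        rw [lintegral_mul_const _ h1, sq]
    _ = ∫⁻ s, ∫⁻ x, ∫⁻ r, ‖F s x‖ₑ * ‖F r x‖ₑ ∂σ ∂ν ∂σ := by
        rw [lintegral_lintegral_swap]
        refine Measurable.aemeasurable ?_
        refine Measurable.lintegral_prod_right (f := fun (p : X × S) (r : S) =>
          ‖F p.2 p.1‖ₑ * ‖F r p.1‖ₑ) ?_
        exact (hm.comp (f := fun q : (X × S) × S => (q.1.2, q.1.1)) (by fun_prop)).mul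
          (hm.comp (f := fun q : (X × S) × S => (q.2, q.1.1)) (by fun_prop))
    _ = ∫⁻ s, ∫⁻ r, ∫⁻ x, ‖F s x‖ₑ * ‖F r x‖ₑ ∂ν ∂σ ∂σ := by
        refine lintegral_congr fun s => ?_
        rw [lintegral_lintegral_swap]
        exact ((hm.comp (f := fun q : X × S => (s, q.1)) (by fun_prop)).mul
          (hm.comp (f := fun q : X × S => (q.2, q.1)) (by fun_prop))).aemeasurable
    _ ≤ ∫⁻ s, ∫⁻ r, eLpNorm (F s) 2 ν * eLpNorm (F r) 2 ν ∂σ ∂σ := by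
        gcongr with s r
        exact lintegral_enorm_mul_le_eLpNorm (hs s).aemeasurable (hs r).aemeasurable
    _ = (∫⁻ s, eLpNorm (F s) 2 ν ∂σ) ^ 2 := by
        have h1 : Measurable fun s => eLpNorm (F s) 2 ν := by
          simp_rw [eLpNorm_eq_lintegral_rpow_enorm_toReal two_ne_zero ENNReal.ofNat_ne_top]
          exact (Measurable.lintegral_prod_right (hm.pow_const _)).pow_const _
        simp_rw [lintegral_const_mul _ h1]
        rw [lintegral_mul_const _ h1, sq]

theorem ae_integrable_of_lintegral_eLpNorm (hF : Measurable (Function.uncurry F))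
    (hfin : ∫⁻ s, eLpNorm (F s) 2 ν ∂σ ≠ ∞) :
    ∀ᵐ x ∂ν, Integrable (fun s => F s x) σ := by
  have hm : Measurable fun p : S × X => ‖F p.1 p.2‖ₑ := hF.enorm
  have h1 : Measurable fun x => (∫⁻ s, ‖F s x‖ₑ ∂σ) ^ 2 :=
    (Measurable.lintegral_prod_left hm).pow_const _
  have h2 := ae_lt_top h1 (ne_top_of_le_ne_top (ENNReal.pow_ne_top hfin)
    (lintegral_sq_lintegral_enorm_le hF))
  filter_upwards [h2] with x hx
  refine ⟨(hF.comp (f := fun s => (s, x)) (by fun_prop)).aestronglyMeasurable, ?_⟩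
  simpa [HasFiniteIntegral, ENNReal.pow_lt_top_iff] using hx

theorem memLp_integral_of_lintegral_eLpNorm (hF : Measurable (Function.uncurry F))
    (hfin : ∫⁻ s, eLpNorm (F s) 2 ν ∂σ ≠ ∞) :
    MemLp (fun x => ∫ s, F s x ∂σ) 2 ν := by
  refine ⟨(StronglyMeasurable.integral_prod_left hF.stronglyMeasurable).aestronglyMeasurable, ?_⟩
  rw [eLpNorm_eq_lintegral_rpow_enorm_toReal two_ne_zero ENNReal.ofNat_ne_top]
  refine ENNReal.rpow_lt_top_of_nonneg (by simp) (ne_of_lt ?_)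
  refine lt_of_le_of_lt ?_ (ENNReal.pow_lt_top (n := 2) hfin.lt_top)
  refine le_trans (lintegral_mono fun x => ?_) (lintegral_sq_lintegral_enorm_le hF)
  simp only [ENNReal.toReal_ofNat, ENNReal.rpow_ofNat]
  gcongr
  exact enorm_integral_le_lintegral_enorm _

theorem integral_mul_integral_of_lintegral_eLpNorm (hF : Measurable (Function.uncurry F))
    (hfin : ∫⁻ s, eLpNorm (F s) 2 ν ∂σ ≠ ∞) {g : X → ℝ} (hg : MemLp g 2 ν) :
    ∫ x, g x * ∫ s, F s x ∂σ ∂ν = ∫ s, ∫ x, g x * F s x ∂ν ∂σ := by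
  rw [integral_integral_swap (f := fun s x => g x * F s x)
    (integrable_prod_mul_of_lintegral_eLpNorm hF hfin hg)]
  simp_rw [integral_const_mul]

end MinkowskiIntegral

/-! ### The Cauchy matrix of the exponents -/

section Cauchy

variable {n : ℕ} {lam : Fin n → ℝ}

theorem add_add_one_pos (hlam : ∀ j, -1 / 2 < lam j) (i j : Fin n) : 0 < lam i + lam j + 1 := by
  linarith [hlam i, hlam j]

/-- The i-th term is p(λ_i)/∏_{l≠i}(λ_i-λ_l) for the polynomial p = ∏_{l≠j}(X+λ_l+1). Lagrange
interpolation at the nodes λ_i makes the sum the coefficient of X^{n-1} in p, and p is monic of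
degree n-1. -/
theorem sum_muntzCoeff_div (hinj : Function.Injective lam) (hlam : ∀ j, -1 / 2 < lam j)
    (j : Fin n) : ∑ i, muntzCoeff lam i * (1 / (lam i + lam j + 1)) = 1 := by
  classical
  let p : Polynomial ℝ :=
    ∏ l ∈ Finset.univ.erase j, (Polynomial.X + Polynomial.C (lam l + 1))
  have hmonic : p.Monic := Polynomial.monic_prod_of_monic _ _ fun l _ => Polynomial.monic_X_add_C _
  have hdeg : p.degree = ((n - 1 : ℕ) : WithBot ℕ) := by
    rw [Polynomial.degree_prod, Finset.sum_congr rfl fun l _ => Polynomial.degree_X_add_C _]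
    simp
  have hn : 0 < n := j.pos
  have h := Lagrange.leadingCoeff_eq_sum (s := Finset.univ) (v := lam) hinj.injOn (P := p) (by
    rw [hdeg, Finset.card_univ, Fintype.card_fin]
    norm_cast
    omega)
  rw [hmonic.leadingCoeff] at h
  refine Eq.trans ?_ h.symm
  refine Finset.sum_congr rfl fun i _ => ?_
  have hpos := (add_add_one_pos hlam i j).ne'
  rw [muntzCoeff, ← Finset.mul_prod_erase Finset.univ _ (Finset.mem_univ j)]
  simp only [p, Polynomial.eval_prod, Polynomial.eval_add, Polynomial.eval_X, Polynomial.eval_C,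
    ← add_assoc]
  field_simp

/-- By `sum_muntzCoeff_div`, column i of the Cauchy matrix C is an eigenvector, with eigenvalue λ_i,
of M = -diag(λ_j+1) + (the matrix with every row equal to a). Distinct eigenvalues make C
invertible, and the last clause is the entrywise form of C⁻¹M = diag(λ)C⁻¹, used to integrate the
differential system. -/
theorem exists_inverse_cauchy (hinj : Function.Injective lam) (hlam : ∀ j, -1 / 2 < lam j) :
    ∃ D : Matrix (Fin n) (Fin n) ℝ,
      (D * (Matrix.of fun j i => 1 / (lam i + lam j + 1)) = 1) ∧
      ((Matrix.of fun j i => 1 / (lam i + lam j + 1)) * D = 1) ∧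
      ∀ i k, -(lam k + 1) * D i k + (∑ j, D i j) * muntzCoeff lam k = lam i * D i k := by
  classical
  set C : Matrix (Fin n) (Fin n) ℝ := Matrix.of fun j i => 1 / (lam i + lam j + 1) with hC
  set M : Matrix (Fin n) (Fin n) ℝ :=
    Matrix.diagonal (fun j => -(lam j + 1)) + Matrix.of fun _ k => muntzCoeff lam k with hM
  have hMC : M * C = C * Matrix.diagonal lam := by
    ext j i
    have h0 := sum_muntzCoeff_div hinj hlam i
    have h1 := (add_add_one_pos hlam i j).ne'
    rw [hM, add_mul, Matrix.add_apply, Matrix.diagonal_mul, Matrix.mul_diagonal, Matrix.mul_apply]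
    simp only [hC, Matrix.of_apply]
    simp_rw [add_comm (lam i) _] at h1 ⊢
    rw [h0]
    field_simp
    ring
  have hunit : IsUnit C := by
    rw [← Matrix.linearIndependent_cols_iff_isUnit]
    refine Module.End.eigenvectors_linearIndependent' (Matrix.toLin' M) lam hinj _ fun i => ?_
    rw [Module.End.hasEigenvector_iff, Module.End.mem_eigenspace_iff]
    constructor
    · rw [Matrix.toLin'_apply]
      ext j
      have := congrFun (congrFun hMC j) i
      rw [Matrix.mul_diagonal, Matrix.mul_apply] at this
      simpa [Matrix.mulVec, dotProduct, mul_comm] using this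
    · intro h
      have := congrFun h i
      simp only [Matrix.col_apply, hC, Matrix.of_apply, Pi.zero_apply] at this
      exact (one_div_pos.2 (add_add_one_pos hlam i i)).ne' this
  obtain ⟨D, hCD, hDC⟩ : ∃ D, C * D = 1 ∧ D * C = 1 :=
    ⟨C⁻¹, Matrix.mul_nonsing_inv _ ((Matrix.isUnit_iff_isUnit_det _).1 hunit),
      Matrix.nonsing_inv_mul _ ((Matrix.isUnit_iff_isUnit_det _).1 hunit)⟩
  refine ⟨D, hDC, hCD, fun i k => ?_⟩
  have hDM : D * M = Matrix.diagonal lam * D := by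
    calc D * M = D * (M * C) * D := by rw [mul_assoc, mul_assoc, hCD, mul_one]
      _ = Matrix.diagonal lam * D := by rw [hMC, ← mul_assoc, hDC, one_mul]
  have := congrFun (congrFun hDM i) k
  rw [Matrix.diagonal_mul, hM, mul_add, Matrix.add_apply, Matrix.mul_diagonal,
    Matrix.mul_apply] at this
  simp only [Matrix.of_apply, ← Finset.sum_mul] at this
  linarith

end Cauchy

/-! ### The space `L²(0,∞)` -/

/-- Lebesgue measure on `(0,∞)`. -/
noncomputable abbrev halfLine : Measure ℝ := volume.restrict (Ioi 0)

theorem memLp_indicator_Ioc {t : ℝ≥0} {f : ℝ → ℝ} (hf : MemL2 t f) :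
    MemLp ((Ioc (0 : ℝ) t).indicator f) 2 halfLine := by
  rw [memLp_indicator_iff_restrict measurableSet_Ioc, Measure.restrict_restrict measurableSet_Ioc,
    inter_eq_left.2 Ioc_subset_Ioi_self]
  exact hf

/-- The class in `L²(0,∞)` of `f` truncated to `(0,t]`. -/
noncomputable def trunc (t : ℝ≥0) {f : ℝ → ℝ} (hf : MemL2 t f) : Lp ℝ 2 halfLine :=
  (memLp_indicator_Ioc hf).toLp

theorem coeFn_trunc (t : ℝ≥0) {f : ℝ → ℝ} (hf : MemL2 t f) :
    trunc t hf =ᵐ[halfLine] (Ioc (0 : ℝ) t).indicator f :=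
  (memLp_indicator_Ioc hf).coeFn_toLp

theorem inner_eq_integral_mul {α : Type*} [MeasurableSpace α] {μ : Measure α} (x y : Lp ℝ 2 μ) :
    ⟪x, y⟫_ℝ = ∫ v, x v * y v ∂μ := by
  rw [L2.inner_def]
  simp [mul_comm]

theorem integral_halfLine_indicator (t : ℝ≥0) (f : ℝ → ℝ) :
    ∫ v, (Ioc (0 : ℝ) t).indicator f v ∂halfLine = ∫ v in Ioc (0 : ℝ) t, f v := by
  rw [integral_indicator measurableSet_Ioc, Measure.restrict_restrict measurableSet_Ioc,
    inter_eq_left.2 Ioc_subset_Ioi_self]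

theorem inner_trunc (t : ℝ≥0) {f : ℝ → ℝ} (hf : MemL2 t f) (x : Lp ℝ 2 halfLine) :
    ⟪trunc t hf, x⟫_ℝ = ∫ v in Ioc (0 : ℝ) t, f v * x v := by
  rw [inner_eq_integral_mul, ← integral_halfLine_indicator]
  refine integral_congr_ae ?_
  filter_upwards [coeFn_trunc t hf] with v hv
  rw [hv, indicator_mul_left]

theorem memL2_one (t : ℝ≥0) : MemL2 t fun _ => (1 : ℝ) := memLp_const 1

/-- The indicator of `(0,t]` in `L²(0,∞)`. -/
noncomputable def oneL2 (t : ℝ≥0) : Lp ℝ 2 halfLine := trunc t (memL2_one t)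

theorem inner_oneL2 (t : ℝ≥0) (x : Lp ℝ 2 halfLine) :
    ⟪oneL2 t, x⟫_ℝ = ∫ v in Ioc (0 : ℝ) t, x v := by
  simp [oneL2, inner_trunc]

theorem ae_restrict_Ioc_of_ae_halfLine {p : ℝ → Prop} (h : ∀ᵐ v ∂halfLine, p v) (t : ℝ≥0) :
    ∀ᵐ v ∂volume.restrict (Ioc (0 : ℝ) t), p v :=
  ae_restrict_of_ae_restrict_of_subset Ioc_subset_Ioi_self h

theorem inner_oneL2_trunc {s t : ℝ≥0} (hst : s ≤ t) {f : ℝ → ℝ} (hf : MemL2 t f) :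
    ⟪oneL2 s, trunc t hf⟫_ℝ = ∫ v in Ioc (0 : ℝ) s, f v := by
  rw [inner_oneL2]
  refine setIntegral_congr_ae measurableSet_Ioc ?_
  filter_upwards [ae_imp_of_ae_restrict (coeFn_trunc t hf)] with v hv h
  have h1 : v ∈ Ioc (0 : ℝ) t := ⟨h.1, h.2.trans (by exact_mod_cast hst)⟩
  rw [hv h.1, indicator_of_mem h1]

theorem inner_oneL2_oneL2 (s t : ℝ≥0) : ⟪oneL2 s, oneL2 t⟫_ℝ = min s t := by
  wlog h : s ≤ t generalizing s t
  · rw [real_inner_comm, this t s (le_of_not_ge h), min_comm]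
  rw [show oneL2 t = trunc t (memL2_one t) from rfl, inner_oneL2_trunc h]
  simp [h]

theorem integrableOn_coeFn (x : Lp ℝ 2 halfLine) (t : ℝ≥0) :
    IntegrableOn x (Ioc (0 : ℝ) t) := by
  have h : MemLp x 2 (volume.restrict (Ioc (0 : ℝ) t)) :=
    (Lp.memLp x).mono_measure (Measure.restrict_mono Ioc_subset_Ioi_self le_rfl)
  exact h.integrable one_le_two

theorem memL2_coeFn (x : Lp ℝ 2 halfLine) (t : ℝ≥0) : MemL2 t x :=
  (Lp.memLp x).mono_measure (Measure.restrict_mono Ioc_subset_Ioi_self le_rfl)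

/-- The primitive of h vanishes identically, while by Lebesgue differentiation its derivative is h
almost everywhere. -/
theorem ae_eq_zero_of_forall_setIntegral_Ioc {t : ℝ≥0} {h : ℝ → ℝ}
    (hi : IntegrableOn h (Ioc (0 : ℝ) t))
    (h0 : ∀ s : ℝ≥0, s ≤ t → ∫ v in Ioc (0 : ℝ) s, h v = 0) :
    ∀ᵐ v ∂volume.restrict (Ioc (0 : ℝ) t), h v = 0 := by
  have hii : IntervalIntegrable h volume 0 t :=
    (intervalIntegrable_iff_integrableOn_Ioc_of_le t.coe_nonneg).2 hi
  have hne : ∀ᵐ v : ℝ, v ≠ t := by simp [ae_iff]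
  rw [ae_restrict_iff' measurableSet_Ioc]
  filter_upwards [hii.ae_hasDerivAt_integral, hne] with v hv hvt hm
  have hd := hv (by rw [uIcc_of_le t.coe_nonneg]; exact Ioc_subset_Icc_self hm) 0 left_mem_uIcc
  have hz : (fun x => ∫ y in (0 : ℝ)..x, h y) =ᶠ[𝓝 v] fun _ => 0 := by
    filter_upwards [Ioo_mem_nhds hm.1 (lt_of_le_of_ne hm.2 hvt)] with x hx
    rw [intervalIntegral.integral_of_le hx.1.le]
    exact h0 ⟨x, hx.1.le⟩ hx.2.le
  exact hd.unique ((hasDerivAt_const v (0 : ℝ)).congr_of_eventuallyEq hz)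

/-- The closed linear span of the indicators of `(0,s]`, `s ≤ t`. -/
noncomputable def spanUpTo (t : ℝ≥0) : Submodule ℝ (Lp ℝ 2 halfLine) :=
  (Submodule.span ℝ (oneL2 '' Iic t)).topologicalClosure

theorem mem_orthogonal_spanUpTo {t : ℝ≥0} {x : Lp ℝ 2 halfLine} :
    x ∈ (spanUpTo t)ᗮ ↔ ∀ s ≤ t, ∫ v in Ioc (0 : ℝ) s, x v = 0 := by
  rw [spanUpTo, Submodule.orthogonal_closure, Submodule.mem_orthogonal]
  constructor
  · intro h s hs
    rw [← inner_oneL2]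
    exact h _ (Submodule.subset_span ⟨s, hs, rfl⟩)
  · intro h u hu
    induction hu using Submodule.span_induction with
    | mem u hu =>
      obtain ⟨s, hs, rfl⟩ := hu
      rw [inner_oneL2, h s hs]
    | zero => simp
    | add a b _ _ ha hb => rw [inner_add_left, ha, hb, add_zero]
    | smul c a _ ha => rw [inner_smul_left, ha, mul_zero]

/-- A closed subspace is its own double orthogonal, and anything orthogonal to the indicators of
(0,s], s ≤ t, vanishes a.e. on (0,t]. -/
theorem trunc_mem_spanUpTo (t : ℝ≥0) {f : ℝ → ℝ} (hf : MemL2 t f) : trunc t hf ∈ spanUpTo t := by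
  have hc : IsClosed (spanUpTo t : Set (Lp ℝ 2 halfLine)) :=
    Submodule.isClosed_topologicalClosure _
  have : CompleteSpace (spanUpTo t) := hc.completeSpace_coe
  rw [← Submodule.orthogonal_orthogonal (spanUpTo t), Submodule.mem_orthogonal']
  intro x hx
  rw [inner_trunc]
  have h0 := ae_eq_zero_of_forall_setIntegral_Ioc (integrableOn_coeFn x t)
    (mem_orthogonal_spanUpTo.1 hx)
  rw [integral_eq_zero_of_ae]
  filter_upwards [h0] with v hv
  simp [hv]

theorem eq_zero_of_forall_inner_oneL2 {x : Lp ℝ 2 halfLine} (h : ∀ s, ⟪oneL2 s, x⟫_ℝ = 0) :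
    x = 0 := by
  rw [Lp.eq_zero_iff_ae_eq_zero]
  have hU : Ioi (0 : ℝ) = ⋃ n : ℕ, Ioc (0 : ℝ) (n : ℝ≥0) := by
    ext v
    simp only [mem_Ioi, mem_iUnion, mem_Ioc, exists_and_left, iff_self_and]
    intro _
    obtain ⟨n, hn⟩ := exists_nat_ge v
    exact ⟨n, by simpa using hn⟩
  change ∀ᵐ v ∂(volume.restrict (Ioi 0)), x v = 0
  rw [hU, ae_restrict_iUnion_iff]
  intro n
  refine ae_eq_zero_of_forall_setIntegral_Ioc (integrableOn_coeFn x n) fun s _ => ?_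
  rw [← inner_oneL2, h]

theorem denseRange_linearCombination_oneL2 :
    DenseRange (Finsupp.linearCombination ℝ oneL2) := by
  have h : (Submodule.span ℝ (range oneL2)).topologicalClosure = ⊤ := by
    rw [Submodule.topologicalClosure_eq_top_iff, Submodule.eq_bot_iff]
    intro x hx
    refine eq_zero_of_forall_inner_oneL2 fun s => ?_
    exact (Submodule.mem_orthogonal _ _).1 hx _ (Submodule.subset_span ⟨s, rfl⟩)
  rw [← Finsupp.range_linearCombination, ← Submodule.dense_iff_topologicalClosure_eq_top] at h
  exact h

/-! ### The Wiener isometry -/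

variable {Ω : Type*} [MeasurableSpace Ω] {P : Measure Ω}

/-- Both families have the same Gram matrix min(s,t), so oneL2 s ↦ b s preserves norms of finite
combinations and extends by density. -/
theorem exists_isometry_of_inner (b : ℝ≥0 → Lp ℝ 2 P)
    (hb : ∀ s t, ⟪b s, b t⟫_ℝ = min s t) :
    ∃ W : Lp ℝ 2 halfLine →ₗᵢ[ℝ] Lp ℝ 2 P, ∀ s, W (oneL2 s) = b s := by
  have hnorm (c : ℝ≥0 →₀ ℝ) : ‖Finsupp.linearCombination ℝ b c‖ =
      ‖Finsupp.linearCombination ℝ oneL2 c‖ := by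
    rw [← sq_eq_sq₀ (norm_nonneg _) (norm_nonneg _), ← real_inner_self_eq_norm_sq,
      ← real_inner_self_eq_norm_sq, Finsupp.linearCombination_apply,
      Finsupp.linearCombination_apply]
    simp only [Finsupp.sum, sum_inner, inner_sum, inner_smul_left, inner_smul_right, hb,
      inner_oneL2_oneL2]
  have hbd : ∃ C : ℝ, ∀ c, ‖Finsupp.linearCombination ℝ b c‖ ≤
      C * ‖Finsupp.linearCombination ℝ oneL2 c‖ := ⟨1, fun c => by rw [one_mul, hnorm]⟩
  let W := (Finsupp.linearCombination ℝ b).extendOfNorm (Finsupp.linearCombination ℝ oneL2)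
  have hW (c : ℝ≥0 →₀ ℝ) :
      W (Finsupp.linearCombination ℝ oneL2 c) = Finsupp.linearCombination ℝ b c :=
    LinearMap.extendOfNorm_eq denseRange_linearCombination_oneL2 hbd c
  refine ⟨⟨W.toLinearMap, fun x => ?_⟩, fun s => ?_⟩
  · refine isClosed_property denseRange_linearCombination_oneL2
      (p := fun x => ‖W x‖ = ‖x‖) (isClosed_eq (by fun_prop) (by fun_prop)) (fun c => ?_) x
    rw [hW, hnorm]
  · simpa using hW (Finsupp.single s 1)

theorem memLp_two_of_isPreBrownianReal {B : ℝ≥0 → Ω → ℝ} (hB : IsPreBrownianReal B P) (s : ℝ≥0) :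
    MemLp (B s) 2 P := (hB.isGaussianProcess.hasGaussianLaw_eval s).memLp_two

/-- The Wiener integral, as an isometry of `L²(0,∞)` into `L²(P)`. -/
theorem exists_wiener_isometry {B : ℝ≥0 → Ω → ℝ} (hB : IsPreBrownianReal B P) :
    ∃ W : Lp ℝ 2 halfLine →ₗᵢ[ℝ] Lp ℝ 2 P, ∀ s, W (oneL2 s) =ᵐ[P] B s := by
  have : IsProbabilityMeasure P := hB.isGaussianProcess.isProbabilityMeasure
  obtain ⟨W, hW⟩ := exists_isometry_of_inner
    (fun s => (memLp_two_of_isPreBrownianReal hB s).toLp) fun s t => by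
      have h := hB.covariance_eval s t
      rw [covariance_eq_sub (memLp_two_of_isPreBrownianReal hB s)
        (memLp_two_of_isPreBrownianReal hB t), hB.integral_eval, zero_mul, sub_zero] at h
      rw [inner_eq_integral_mul, ← h]
      refine integral_congr_ae ?_
      filter_upwards [(memLp_two_of_isPreBrownianReal hB s).coeFn_toLp,
        (memLp_two_of_isPreBrownianReal hB t).coeFn_toLp] with ω h1 h2
      rw [h1, h2]
      rfl
  exact ⟨W, fun s => by rw [hW]; exact (memLp_two_of_isPreBrownianReal hB s).coeFn_toLp⟩

/-! ### Wiener integrals as values of the isometry -/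

theorem coeFn_finset_sum {α ι : Type*} [MeasurableSpace α] {μ : Measure α} (s : Finset ι)
    (x : ι → Lp ℝ 2 μ) {y : ι → α → ℝ} (h : ∀ i ∈ s, x i =ᵐ[μ] y i) :
    (∑ i ∈ s, x i : Lp ℝ 2 μ) =ᵐ[μ] fun a => ∑ i ∈ s, y i a := by
  classical
  induction s using Finset.induction_on with
  | empty =>
    simp only [Finset.sum_empty]
    exact Lp.coeFn_zero ℝ 2 μ
  | insert i s hi ih =>
    rw [Finset.sum_insert hi]
    filter_upwards [Lp.coeFn_add (x i) (∑ i ∈ s, x i), h i (Finset.mem_insert_self i s),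
      ih fun j hj => h j (Finset.mem_insert_of_mem hj)] with a h1 h2 h3
    rw [h1, Pi.add_apply, h2, h3, Finset.sum_insert hi]

theorem coeFn_smul_of_ae {α : Type*} [MeasurableSpace α] {μ : Measure α} (c : ℝ) {x : Lp ℝ 2 μ}
    {y : α → ℝ} (h : x =ᵐ[μ] y) : (c • x : Lp ℝ 2 μ) =ᵐ[μ] fun a => c * y a := by
  filter_upwards [Lp.coeFn_smul c x, h] with a h1 h2
  rw [h1, Pi.smul_apply, h2, smul_eq_mul]

theorem coeFn_sub_of_ae {α : Type*} [MeasurableSpace α] {μ : Measure α} {x x' : Lp ℝ 2 μ}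
    {y y' : α → ℝ} (h : x =ᵐ[μ] y) (h' : x' =ᵐ[μ] y') :
    (x - x' : Lp ℝ 2 μ) =ᵐ[μ] fun a => y a - y' a := by
  filter_upwards [Lp.coeFn_sub x x', h, h'] with a h1 h2 h3
  rw [h1, Pi.sub_apply, h2, h3]

/-- The class in `L²(0,∞)` of a step function. -/
noncomputable def StepFun.toL2 {t : ℝ≥0} (φ : StepFun t) : Lp ℝ 2 halfLine :=
  ∑ i, φ.c i • (oneL2 (φ.b i) - oneL2 (φ.a i))

theorem coeFn_oneL2 (s : ℝ≥0) :
    oneL2 s =ᵐ[halfLine] (Ioc (0 : ℝ) s).indicator fun _ => (1 : ℝ) :=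
  coeFn_trunc s _

theorem StepFun.coeFn_toL2 {t : ℝ≥0} (φ : StepFun t) : φ.toL2 =ᵐ[halfLine] φ.eval := by
  refine (coeFn_finset_sum _ _ fun i _ => coeFn_smul_of_ae (φ.c i)
    (coeFn_sub_of_ae (coeFn_oneL2 (φ.b i)) (coeFn_oneL2 (φ.a i)))).trans ?_
  filter_upwards [ae_restrict_mem measurableSet_Ioi] with v hv
  refine Finset.sum_congr rfl fun i _ => ?_
  have hab : (φ.a i : ℝ) ≤ φ.b i := by exact_mod_cast φ.a_le_b i
  have hv : 0 < v := hv
  congr 1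
  simp only [indicator, mem_Ioc, hv, true_and]
  grind

theorem StepFun.indicator_eval {t : ℝ≥0} (φ : StepFun t) :
    ∀ v, 0 < v → (Ioc (0 : ℝ) t).indicator φ.eval v = φ.eval v := by
  intro v hv
  by_cases h : v ≤ t
  · exact indicator_of_mem (show v ∈ Ioc (0 : ℝ) t from ⟨hv, h⟩) _
  · rw [indicator_of_notMem fun h' => h h'.2, StepFun.eval]
    refine (Finset.sum_eq_zero fun i _ => ?_).symm
    rw [indicator_of_notMem, mul_zero]
    rintro ⟨_, h2⟩
    exact h (h2.trans (by exact_mod_cast φ.b_le i))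

/-- Both functions vanish beyond t, so the L²(0,∞) distance is the L² distance on (0,t] used in
`IsWienerIntegral`. -/
theorem enorm_trunc_sub_toL2 {t : ℝ≥0} {f : ℝ → ℝ} (hf : MemL2 t f) (φ : StepFun t) :
    ‖trunc t hf - φ.toL2‖ₑ =
      eLpNorm (fun s => f s - φ.eval s) 2 (volume.restrict (Ioc (0 : ℝ) t)) := by
  rw [Lp.enorm_def, ← inter_eq_left.2 (Ioc_subset_Ioi_self : Ioc (0 : ℝ) t ⊆ Ioi 0),
    ← Measure.restrict_restrict measurableSet_Ioc,
    ← eLpNorm_indicator_eq_eLpNorm_restrict measurableSet_Ioc]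
  refine eLpNorm_congr_ae ?_
  filter_upwards [coeFn_sub_of_ae (coeFn_trunc t hf) φ.coeFn_toL2,
    ae_restrict_mem measurableSet_Ioi] with v hv hpos
  rw [hv, ← φ.indicator_eval v hpos]
  exact (congrFun (indicator_sub (Ioc (0 : ℝ) t) f φ.eval) v).symm

theorem oneL2_zero : oneL2 0 = 0 := by
  rw [← inner_self_eq_zero (𝕜 := ℝ), inner_oneL2_oneL2]
  simp

theorem exists_stepFun_toL2_eq {t : ℝ≥0} {x : Lp ℝ 2 halfLine}
    (hx : x ∈ Submodule.span ℝ (oneL2 '' Iic t)) : ∃ φ : StepFun t, φ.toL2 = x := by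
  obtain ⟨m, c, g, rfl⟩ := Submodule.mem_span_set'.1 hx
  choose b hb hgb using fun i => (g i).2
  -- Left endpoints 0 suffice, since the generators are indicators of (0,b] and `oneL2 0` is zero.
  refine ⟨⟨m, c, fun _ => 0, b, fun _ => bot_le, hb⟩, ?_⟩
  simp [StepFun.toL2, oneL2_zero, hgb]

theorem StepFun.integral_ae_eq {B : ℝ≥0 → Ω → ℝ} {W : Lp ℝ 2 halfLine →ₗᵢ[ℝ] Lp ℝ 2 P}
    (hW : ∀ s, W (oneL2 s) =ᵐ[P] B s) {t : ℝ≥0} (φ : StepFun t) :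
    W φ.toL2 =ᵐ[P] φ.integral B := by
  simp only [StepFun.toL2, map_sum, map_smul, map_sub]
  exact coeFn_finset_sum _ _ fun i _ => coeFn_smul_of_ae (φ.c i)
    (coeFn_sub_of_ae (hW (φ.b i)) (hW (φ.a i)))

theorem tendsto_iff_tendsto_enorm_sub {E ι : Type*} [NormedAddCommGroup E] {l : Filter ι}
    {u : ι → E} {a : E} : Tendsto u l (𝓝 a) ↔ Tendsto (fun k => ‖a - u k‖ₑ) l (𝓝 0) := by
  rw [tendsto_iff_edist_tendsto_0]
  simp_rw [edist_comm _ a, edist_eq_enorm_sub]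

/-- `W` turns convergence of step functions into convergence of their elementary integrals.
Uniqueness of limits gives one direction; density of step functions in the span up to t gives the
other. -/
theorem isWienerIntegral_iff {B : ℝ≥0 → Ω → ℝ} {W : Lp ℝ 2 halfLine →ₗᵢ[ℝ] Lp ℝ 2 P}
    (hW : ∀ s, W (oneL2 s) =ᵐ[P] B s) {t : ℝ≥0} {f : ℝ → ℝ} (hf : MemL2 t f) {Z : Ω → ℝ} :
    IsWienerIntegral P B t f Z ↔ Z =ᵐ[P] W (trunc t hf) := by
  have key (hZ : MemLp Z 2 P) (φ : StepFun t) :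
      ‖hZ.toLp - W φ.toL2‖ₑ = eLpNorm (fun ω => Z ω - φ.integral B ω) 2 P := by
    rw [Lp.enorm_def]
    exact eLpNorm_congr_ae (coeFn_sub_of_ae hZ.coeFn_toLp (φ.integral_ae_eq hW))
  constructor
  · rintro ⟨-, hZ, φ, h1, h2⟩
    simp_rw [← enorm_trunc_sub_toL2 hf] at h1
    simp_rw [← key hZ] at h2
    rw [← tendsto_iff_tendsto_enorm_sub] at h1 h2
    have h3 : Tendsto (fun k => W (φ k).toL2) atTop (𝓝 (W (trunc t hf))) :=
      (W.continuous.tendsto _).comp h1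
    rw [← tendsto_nhds_unique h2 h3]
    exact hZ.coeFn_toLp.symm
  · intro h
    have hZ : MemLp Z 2 P := (memLp_congr_ae h).2 (Lp.memLp _)
    have hZW : hZ.toLp = W (trunc t hf) := Lp.ext (hZ.coeFn_toLp.trans h)
    obtain ⟨u, hu, hlim⟩ := mem_closure_iff_seq_limit.1 (trunc_mem_spanUpTo t hf)
    choose φ hφ using fun k => exists_stepFun_toL2_eq (hu k)
    refine ⟨hf, hZ, φ, ?_, ?_⟩
    · simp_rw [← enorm_trunc_sub_toL2 hf]
      rw [← tendsto_iff_tendsto_enorm_sub]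
      simpa only [hφ] using hlim
    · simp_rw [← key hZ]
      rw [← tendsto_iff_tendsto_enorm_sub, hZW]
      simpa only [hφ, Function.comp_def] using (W.continuous.tendsto _).comp hlim

/-! ### Gaussian processes in the range of the isometry -/

theorem integral_coeFn_eq_zero {B : ℝ≥0 → Ω → ℝ} (hB : IsPreBrownianReal B P)
    {W : Lp ℝ 2 halfLine →ₗᵢ[ℝ] Lp ℝ 2 P} (hW : ∀ s, W (oneL2 s) =ᵐ[P] B s)
    (x : Lp ℝ 2 halfLine) : ∫ ω, W x ω ∂P = 0 := by
  have : IsProbabilityMeasure P := hB.isGaussianProcess.isProbabilityMeasure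
  have hone (Z : Lp ℝ 2 P) : ⟪(memLp_const (1 : ℝ)).toLp, Z⟫_ℝ = ∫ ω, Z ω ∂P := by
    rw [inner_eq_integral_mul]
    refine integral_congr_ae ?_
    filter_upwards [(memLp_const (p := 2) (μ := P) (1 : ℝ)).coeFn_toLp] with ω hω
    rw [hω, one_mul]
  rw [← hone]
  refine isClosed_property denseRange_linearCombination_oneL2
    (p := fun x => ⟪(memLp_const (1 : ℝ)).toLp, W x⟫_ℝ = 0)
    (isClosed_eq (by fun_prop) (by fun_prop)) (fun c => ?_) x
  rw [Finsupp.linearCombination_apply, Finsupp.sum, map_sum, inner_sum]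
  refine Finset.sum_eq_zero fun s _ => ?_
  rw [map_smul, inner_smul_right, hone, integral_congr_ae (hW s), hB.integral_eval, mul_zero]

theorem variance_coeFn {B : ℝ≥0 → Ω → ℝ} (hB : IsPreBrownianReal B P)
    {W : Lp ℝ 2 halfLine →ₗᵢ[ℝ] Lp ℝ 2 P} (hW : ∀ s, W (oneL2 s) =ᵐ[P] B s)
    (x : Lp ℝ 2 halfLine) : Var[W x; P] = ‖x‖ ^ 2 := by
  rw [variance_of_integral_eq_zero (Lp.memLp _).1.aemeasurable (integral_coeFn_eq_zero hB hW x),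
    ← W.norm_map, ← real_inner_self_eq_norm_sq, inner_eq_integral_mul]
  simp [sq]

/-- The map is 1-Lipschitz, because |e^{ia} - e^{ib}| ≤ |a - b| and the L¹ norm is at most the L²
norm under a probability. It carries Gaussian characteristic functions through L² limits. -/
theorem continuous_integral_cexp [IsProbabilityMeasure P] :
    Continuous fun Z : Lp ℝ 2 P => ∫ ω, Complex.exp (Z ω * Complex.I) ∂P := by
  have hint (Z : Lp ℝ 2 P) : Integrable (fun ω => Complex.exp (Z ω * Complex.I)) P := by
    refine Integrable.mono' (integrable_const (1 : ℝ)) ?_ ?_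
    · have hc : Continuous fun r : ℝ => Complex.exp (r * Complex.I) := by fun_prop
      exact hc.comp_aestronglyMeasurable (Lp.aestronglyMeasurable Z)
    · filter_upwards with ω
      rw [Complex.norm_exp_ofReal_mul_I]
  have hlip : LipschitzWith 1 fun Z : Lp ℝ 2 P => ∫ ω, Complex.exp (Z ω * Complex.I) ∂P := by
    refine LipschitzWith.of_dist_le_mul fun Z Z' => ?_
    rw [dist_eq_norm, dist_eq_norm, ← integral_sub (hint Z) (hint Z'), NNReal.coe_one, one_mul]
    calc ‖∫ ω, (Complex.exp (Z ω * Complex.I) - Complex.exp (Z' ω * Complex.I)) ∂P‖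
        ≤ ∫ ω, ‖(Z - Z') ω‖ ∂P := by
          refine norm_integral_le_of_norm_le ((Lp.memLp (Z - Z')).integrable one_le_two).norm ?_
          filter_upwards [Lp.coeFn_sub Z Z'] with ω hω
          rw [hω, Pi.sub_apply]
          have h1 : Complex.exp (Z ω * Complex.I) - Complex.exp (Z' ω * Complex.I) =
              Complex.exp (Z' ω * Complex.I) *
                (Complex.exp (Complex.I * ((Z ω - Z' ω : ℝ) : ℂ)) - 1) := by
            rw [mul_sub, ← Complex.exp_add]
            push_cast
            ring_nf
          rw [h1, norm_mul, Complex.norm_exp_ofReal_mul_I, one_mul]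
          exact Real.norm_exp_I_mul_ofReal_sub_one_le
      _ ≤ ‖Z - Z'‖ := by
          have h2 := eLpNorm_le_eLpNorm_of_exponent_le (μ := P) (one_le_two (α := ℝ≥0∞))
            (Lp.aestronglyMeasurable (Z - Z'))
          rw [Lp.norm_def, integral_norm_eq_lintegral_enorm (Lp.aestronglyMeasurable _),
            ← eLpNorm_one_eq_lintegral_enorm]
          exact ENNReal.toReal_mono (Lp.eLpNorm_ne_top _) h2
  exact hlip.continuous

theorem integral_cexp_coeFn {B : ℝ≥0 → Ω → ℝ} (hB : IsPreBrownianReal B P)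
    {W : Lp ℝ 2 halfLine →ₗᵢ[ℝ] Lp ℝ 2 P} (hW : ∀ s, W (oneL2 s) =ᵐ[P] B s)
    (x : Lp ℝ 2 halfLine) :
    ∫ ω, Complex.exp (W x ω * Complex.I) ∂P = Complex.exp (-((‖x‖ ^ 2 : ℝ) : ℂ) / 2) := by
  have : IsProbabilityMeasure P := hB.isGaussianProcess.isProbabilityMeasure
  refine isClosed_property denseRange_linearCombination_oneL2
    (p := fun x => ∫ ω, Complex.exp (W x ω * Complex.I) ∂P =
      Complex.exp (-((‖x‖ ^ 2 : ℝ) : ℂ) / 2))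
    (isClosed_eq (continuous_integral_cexp.comp W.continuous) (by fun_prop)) (fun c => ?_) x
  set y := Finsupp.linearCombination ℝ oneL2 c with hy
  have hg : HasGaussianLaw (W y) P := by
    refine ((hB.isGaussianProcess.smul c).hasGaussianLaw_fun_sum (I := c.support)).congr ?_
    rw [hy, Finsupp.linearCombination_apply, Finsupp.sum, map_sum]
    refine (coeFn_finset_sum _ _ fun s _ => ?_).symm
    rw [map_smul]
    exact coeFn_smul_of_ae (c s) (hW s)
  have h := hg.charFun_map_eq 1
  rw [charFun_apply, integral_map hg.aemeasurable (by fun_prop)] at h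
  simpa [integral_coeFn_eq_zero hB hW y, variance_coeFn hB hW y, neg_div] using h

/-- A linear form of finitely many T_t is again `W y` for some y, so `integral_cexp_coeFn` supplies
its Gaussian characteristic function. -/
theorem isGaussianProcess_of_isometry {B : ℝ≥0 → Ω → ℝ} (hB : IsPreBrownianReal B P)
    {W : Lp ℝ 2 halfLine →ₗᵢ[ℝ] Lp ℝ 2 P} (hW : ∀ s, W (oneL2 s) =ᵐ[P] B s)
    {T : ℝ≥0 → Ω → ℝ} {x : ℝ≥0 → Lp ℝ 2 halfLine} (hT : ∀ t, T t =ᵐ[P] W (x t)) :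
    IsGaussianProcess T P where
  hasGaussianLaw I := by
    classical
    have : IsProbabilityMeasure P := hB.isGaussianProcess.isProbabilityMeasure
    have hTm (t : ℝ≥0) : AEMeasurable (T t) P :=
      (Lp.memLp (W (x t))).1.aemeasurable.congr (hT t).symm
    have hm : AEMeasurable (fun ω => I.restrict (T · ω)) P :=
      aemeasurable_pi_lambda _ fun i => hTm i
    rw [hasGaussianLaw_iff_charFunDual_map_eq hm]
    intro L
    set y : Lp ℝ 2 halfLine := ∑ i : I, L (Pi.single i 1) • x i with hy
    have hL : (L ∘ fun ω => I.restrict (T · ω)) =ᵐ[P] W y := by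
      rw [hy, map_sum]
      refine EventuallyEq.trans ?_ (coeFn_finset_sum _ _
        (y := fun i ω => L (Pi.single i 1) * T i ω) fun i _ => ?_).symm
      · filter_upwards with ω
        rw [Function.comp_apply, ← ContinuousLinearMap.coe_coe, LinearMap.pi_apply_eq_sum_univ]
        refine Finset.sum_congr rfl fun i _ => ?_
        rw [smul_eq_mul, mul_comm]
        congr 2
        ext j
        simp [Pi.single_apply, eq_comm]
      · rw [map_smul]
        exact coeFn_smul_of_ae _ (hT i).symm
    rw [integral_congr_ae hL, variance_congr hL, integral_coeFn_eq_zero hB hW,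
      variance_coeFn hB hW, charFunDual_apply, integral_map hm (by fun_prop)]
    have h := integral_cexp_coeFn hB hW y
    rw [← integral_congr_ae (g := fun ω => Complex.exp (W y ω * Complex.I))
      (f := fun ω => Complex.exp (L (I.restrict (T · ω)) * Complex.I))] at h
    · rw [h]
      push_cast
      ring_nf
    · filter_upwards [hL] with ω hω
      rw [← hω]
      rfl

theorem isPreBrownianReal_of_isometry {B : ℝ≥0 → Ω → ℝ} (hB : IsPreBrownianReal B P)
    {W : Lp ℝ 2 halfLine →ₗᵢ[ℝ] Lp ℝ 2 P} (hW : ∀ s, W (oneL2 s) =ᵐ[P] B s)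
    {T : ℝ≥0 → Ω → ℝ} {x : ℝ≥0 → Lp ℝ 2 halfLine} (hT : ∀ t, T t =ᵐ[P] W (x t))
    (hx : ∀ s t, s ≤ t → ⟪x s, x t⟫_ℝ = s) : IsPreBrownianReal T P := by
  have : IsProbabilityMeasure P := hB.isGaussianProcess.isProbabilityMeasure
  have hmean (t : ℝ≥0) : P[T t] = 0 := by
    rw [integral_congr_ae (hT t), integral_coeFn_eq_zero hB hW]
  have hmem (t : ℝ≥0) : MemLp (T t) 2 P := (memLp_congr_ae (hT t)).2 (Lp.memLp _)
  refine (isGaussianProcess_of_isometry hB hW hT).isPreBrownianReal_of_covariance hmean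
    fun s t hst => ?_
  rw [covariance_eq_sub (hmem s) (hmem t), hmean, zero_mul, sub_zero, ← hx s t hst,
    ← W.inner_map_map, inner_eq_integral_mul]
  exact integral_congr_ae ((hT s).mul (hT t))

/-! ### Stochastic Fubini theorem -/

/-- Test against an arbitrary Z: moving `W` onto Z by its adjoint, Fubini on P and Fubini on the
half-line reduce both sides to ∫ ⟨Z, W (x s)⟩ dσ(s). -/
theorem isometry_integral_ae_eq {S : Type*} [MeasurableSpace S] {σ : Measure S} [SFinite σ]
    [SFinite P] (W : Lp ℝ 2 halfLine →ₗᵢ[ℝ] Lp ℝ 2 P) {l : S → ℝ → ℝ} {Y : S → Ω → ℝ}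
    {x : S → Lp ℝ 2 halfLine}
    (hl : Measurable (Function.uncurry l)) (hY : Measurable (Function.uncurry Y))
    (hx : ∀ᵐ s ∂σ, x s =ᵐ[halfLine] l s) (hYx : ∀ᵐ s ∂σ, Y s =ᵐ[P] W (x s))
    (hfin : ∫⁻ s, eLpNorm (l s) 2 halfLine ∂σ ≠ ∞) :
    (∀ᵐ ω ∂P, Integrable (fun s => Y s ω) σ) ∧
      (fun ω => ∫ s, Y s ω ∂σ) =ᵐ[P] W (memLp_integral_of_lintegral_eLpNorm hl hfin).toLp := by
  have hfinY : ∫⁻ s, eLpNorm (Y s) 2 P ∂σ ≠ ∞ := by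
    rw [lintegral_congr_ae (g := fun s => eLpNorm (l s) 2 halfLine)]
    · exact hfin
    · filter_upwards [hx, hYx] with s h1 h2
      rw [eLpNorm_congr_ae h2, ← eLpNorm_congr_ae h1, ← Lp.enorm_def, ← Lp.enorm_def,
        W.enorm_map]
  refine ⟨ae_integrable_of_lintegral_eLpNorm hY hfinY, ?_⟩
  set hU := memLp_integral_of_lintegral_eLpNorm hY hfinY
  set hm := memLp_integral_of_lintegral_eLpNorm hl hfin
  refine hU.coeFn_toLp.symm.trans ?_
  have h : hU.toLp = W hm.toLp := by
    refine ext_inner_left ℝ fun Z => ?_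
    let A := W.toContinuousLinearMap.adjoint
    have hA (y : Lp ℝ 2 halfLine) : ⟪Z, W y⟫_ℝ = ⟪A Z, y⟫_ℝ :=
      (ContinuousLinearMap.adjoint_inner_left W.toContinuousLinearMap y Z).symm
    rw [hA, inner_eq_integral_mul, inner_eq_integral_mul]
    have e1 : ∫ ω, Z ω * hU.toLp _ ω ∂P = ∫ ω, Z ω * ∫ s, Y s ω ∂σ ∂P := by
      refine integral_congr_ae ?_
      filter_upwards [hU.coeFn_toLp] with ω hω
      rw [hω]
    have e2 : ∫ v, A Z v * hm.toLp _ v ∂halfLine = ∫ v, A Z v * ∫ s, l s v ∂σ ∂halfLine := by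
      refine integral_congr_ae ?_
      filter_upwards [hm.coeFn_toLp] with ω hω
      rw [hω]
    rw [e1, e2, integral_mul_integral_of_lintegral_eLpNorm hY hfinY (Lp.memLp Z),
      integral_mul_integral_of_lintegral_eLpNorm hl hfin (Lp.memLp (A Z))]
    refine integral_congr_ae ?_
    filter_upwards [hx, hYx] with s h1 h2
    have e3 : ∫ ω, Z ω * Y s ω ∂P = ⟪Z, W (x s)⟫_ℝ := by
      rw [inner_eq_integral_mul]
      refine integral_congr_ae ?_
      filter_upwards [h2] with ω hω
      rw [hω]
    rw [e3, hA, inner_eq_integral_mul]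
    refine integral_congr_ae ?_
    filter_upwards [h1] with v hv
    rw [hv]
  rw [h]

/-! ### Powers and the Müntz kernel in `L²(0,∞)` -/

theorem setIntegral_Ioc_rpow {a : ℝ} (ha : -1 < a) (s : ℝ≥0) :
    ∫ v in Ioc (0 : ℝ) s, v ^ a = (s : ℝ) ^ (a + 1) / (a + 1) := by
  rw [← intervalIntegral.integral_of_le s.coe_nonneg, integral_rpow (Or.inl ha),
    Real.zero_rpow (by linarith), sub_zero]

theorem integrableOn_Ioc_rpow {a : ℝ} (ha : -1 < a) (s : ℝ≥0) :
    IntegrableOn (fun v : ℝ => v ^ a) (Ioc (0 : ℝ) s) :=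
  (intervalIntegrable_iff_integrableOn_Ioc_of_le s.coe_nonneg).1
    (intervalIntegral.intervalIntegrable_rpow' ha)

theorem memL2_rpow (t : ℝ≥0) {a : ℝ} (ha : -1 / 2 < a) : MemL2 t fun s => s ^ a := by
  rw [MemL2, memLp_two_iff_integrable_sq (by fun_prop)]
  refine (integrableOn_Ioc_rpow (a := a + a) (by linarith) t).congr_fun (fun v hv => ?_)
    measurableSet_Ioc
  simp only
  rw [Real.rpow_add hv.1, sq]

/-- The power `s ^ a` truncated to `(0,t]`, in `L²(0,∞)`. -/
noncomputable def powL2 (t : ℝ≥0) {a : ℝ} (ha : -1 / 2 < a) : Lp ℝ 2 halfLine :=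
  trunc t (memL2_rpow t ha)

theorem inner_powL2_powL2 {s t : ℝ≥0} (hst : s ≤ t) {a b : ℝ} (ha : -1 / 2 < a)
    (hb : -1 / 2 < b) :
    ⟪powL2 t ha, powL2 s hb⟫_ℝ = (s : ℝ) ^ (a + b + 1) / (a + b + 1) := by
  rw [real_inner_comm, powL2, inner_trunc, ← setIntegral_Ioc_rpow (by linarith)]
  refine setIntegral_congr_ae measurableSet_Ioc ?_
  filter_upwards [ae_imp_of_ae_restrict (coeFn_trunc t (memL2_rpow t ha))] with v hv h
  have h1 : v ∈ Ioc (0 : ℝ) t := ⟨h.1, h.2.trans (by exact_mod_cast hst)⟩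
  rw [powL2, hv h.1, indicator_of_mem h1, Real.rpow_add h.1, mul_comm]

section Kernel

variable {n : ℕ} {lam : Fin n → ℝ}

theorem muntzKernel_eq_sum {s v : ℝ} (hv : 0 < v) (hvs : v ≤ s) :
    muntzKernel lam s v = ∑ j, muntzCoeff lam j * s ^ (-(lam j + 1)) * v ^ lam j := by
  have hs : 0 < s := hv.trans_le hvs
  rw [muntzKernel, if_pos hvs, muntzK, Finset.mul_sum]
  refine Finset.sum_congr rfl fun j _ => ?_
  rw [Real.div_rpow hv.le hs.le, Real.rpow_neg hs.le, Real.rpow_add_one hs.ne']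
  field_simp

theorem measurable_uncurry_muntzKernel (lam : Fin n → ℝ) :
    Measurable (Function.uncurry (muntzKernel lam)) := by
  unfold muntzKernel muntzK Function.uncurry
  refine Measurable.ite (measurableSet_le measurable_snd measurable_fst) ?_ measurable_const
  fun_prop

/-- The Müntz kernel `k_n(s,·)` in `L²(0,∞)`. -/
noncomputable def kernelL2 (hlam : ∀ j, -1 / 2 < lam j) (s : ℝ≥0) : Lp ℝ 2 halfLine :=
  ∑ j, (muntzCoeff lam j * (s : ℝ) ^ (-(lam j + 1))) • powL2 s (hlam j)

theorem coeFn_kernelL2 (hlam : ∀ j, -1 / 2 < lam j) (s : ℝ≥0) :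
    kernelL2 hlam s =ᵐ[halfLine] muntzKernel lam s := by
  refine (coeFn_finset_sum _ _ fun j _ => coeFn_smul_of_ae _
    (coeFn_trunc s (memL2_rpow s (hlam j)))).trans ?_
  filter_upwards [ae_restrict_mem measurableSet_Ioi] with v hv
  by_cases h : v ≤ s
  · have h1 : v ∈ Ioc (0 : ℝ) s := ⟨hv, h⟩
    simp only [muntzKernel_eq_sum hv h, indicator_of_mem h1]
  · have h1 : v ∉ Ioc (0 : ℝ) s := fun h' => h h'.2
    simp [muntzKernel, h]

theorem ae_coeFn_kernelL2 (hlam : ∀ j, -1 / 2 < lam j) (t : ℝ≥0) :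
    ∀ᵐ s ∂volume.restrict (Ioc (0 : ℝ) t),
      kernelL2 hlam s.toNNReal =ᵐ[halfLine] muntzKernel lam s := by
  filter_upwards [ae_restrict_mem measurableSet_Ioc] with s hs
  have h := coeFn_kernelL2 hlam s.toNNReal
  rwa [Real.coe_toNNReal s hs.1.le] at h

/-- The reproducing property: each pairing of powers contributes a factor 1/(λ_i+λ_j+1), and the
weighted sum of these is 1 by `sum_muntzCoeff_div`. -/
theorem inner_powL2_kernelL2 (hinj : Function.Injective lam) (hlam : ∀ j, -1 / 2 < lam j)
    {s t : ℝ≥0} (hs : 0 < s) (hst : s ≤ t) (i : Fin n) :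
    ⟪powL2 t (hlam i), kernelL2 hlam s⟫_ℝ = (s : ℝ) ^ lam i := by
  have hs' : (0 : ℝ) < s := by exact_mod_cast hs
  simp only [kernelL2, inner_sum, inner_smul_right, inner_powL2_powL2 hst]
  trans ∑ j, (s : ℝ) ^ lam i * (muntzCoeff lam j * (1 / (lam j + lam i + 1)))
  swap
  · rw [← Finset.mul_sum, sum_muntzCoeff_div hinj hlam i, mul_one]
  refine Finset.sum_congr rfl fun j _ => ?_
  have h : (s : ℝ) ^ (lam i + lam j + 1) = (s : ℝ) ^ lam i * (s : ℝ) ^ (lam j + 1) := by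
    rw [← Real.rpow_add hs', add_assoc]
  have hp := (Real.rpow_pos_of_pos hs' (lam j + 1)).ne'
  rw [h, Real.rpow_neg hs'.le, add_comm (lam j) (lam i)]
  field_simp

theorem inner_kernelL2_kernelL2 (hinj : Function.Injective lam) (hlam : ∀ j, -1 / 2 < lam j)
    {s t : ℝ≥0} (hs : 0 < s) (hst : s ≤ t) :
    ⟪kernelL2 hlam t, kernelL2 hlam s⟫_ℝ = muntzKernel lam t s := by
  rw [muntzKernel_eq_sum (by exact_mod_cast hs) (by exact_mod_cast hst)]
  nth_rw 1 [kernelL2]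
  simp only [sum_inner, inner_smul_left, inner_powL2_kernelL2 hinj hlam hs hst]
  rfl

/-- By self-reproduction the squared norm is k_n(s,s) = K_n(1)/s. The resulting s^{-1/2} is
integrable at 0, which every integral in s of the kernels relies on. -/
theorem norm_kernelL2 (hinj : Function.Injective lam) (hlam : ∀ j, -1 / 2 < lam j)
    {s : ℝ≥0} (hs : 0 < s) :
    ‖kernelL2 hlam s‖ = √(muntzK lam 1) * (s : ℝ) ^ (-1 / 2 : ℝ) := by
  have hs' : (0 : ℝ) < s := by exact_mod_cast hs
  rw [norm_eq_sqrt_real_inner, inner_kernelL2_kernelL2 hinj hlam hs le_rfl, muntzKernel,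
    if_pos le_rfl, div_self hs'.ne', mul_comm, Real.sqrt_mul' _ (inv_nonneg.2 hs'.le),
    neg_div, Real.rpow_neg hs'.le, Real.sqrt_inv, Real.sqrt_eq_rpow (s : ℝ)]

theorem lintegral_eLpNorm_muntzKernel_ne_top (hinj : Function.Injective lam)
    (hlam : ∀ j, -1 / 2 < lam j) (t : ℝ≥0) :
    ∫⁻ s in Ioc (0 : ℝ) t, eLpNorm (muntzKernel lam s) 2 halfLine ≠ ∞ := by
  have hi : IntegrableOn (fun s : ℝ => √(muntzK lam 1) * s ^ (-1 / 2 : ℝ)) (Ioc (0 : ℝ) t) :=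
    (integrableOn_Ioc_rpow (by norm_num) t).const_mul _
  refine ne_of_eq_of_ne (setLIntegral_congr_fun measurableSet_Ioc fun s hs => ?_) hi.2.ne
  have h := coeFn_kernelL2 hlam s.toNNReal
  rw [Real.coe_toNNReal s hs.1.le] at h
  simp only
  rw [← eLpNorm_congr_ae h, ← Lp.enorm_def, ← ofReal_norm,
    norm_kernelL2 hinj hlam (Real.toNNReal_pos.2 hs.1), Real.coe_toNNReal s hs.1.le,
    Real.enorm_of_nonneg (by have := hs.1; positivity)]

/-- The class in `L²(0,∞)` of `v ↦ ∫_0^t k_n(s,v) ds`. -/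
noncomputable def primitiveL2 (hinj : Function.Injective lam) (hlam : ∀ j, -1 / 2 < lam j)
    (t : ℝ≥0) : Lp ℝ 2 halfLine :=
  (memLp_integral_of_lintegral_eLpNorm (measurable_uncurry_muntzKernel lam)
    (lintegral_eLpNorm_muntzKernel_ne_top hinj hlam t)).toLp

theorem coeFn_primitiveL2 (hinj : Function.Injective lam) (hlam : ∀ j, -1 / 2 < lam j)
    (t : ℝ≥0) :
    primitiveL2 hinj hlam t =ᵐ[halfLine] fun v => ∫ s in Ioc (0 : ℝ) t, muntzKernel lam s v :=
  MemLp.coeFn_toLp _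

theorem inner_kernelL2_eq_integral (hlam : ∀ j, -1 / 2 < lam j) (x : Lp ℝ 2 halfLine)
    {s : ℝ} (hs : 0 < s) :
    ⟪x, kernelL2 hlam s.toNNReal⟫_ℝ = ∫ v, x v * muntzKernel lam s v ∂halfLine := by
  rw [inner_eq_integral_mul]
  refine integral_congr_ae ?_
  have h := coeFn_kernelL2 hlam s.toNNReal
  rw [Real.coe_toNNReal s hs.le] at h
  filter_upwards [h] with v hv
  rw [hv]

theorem integrableOn_inner_kernelL2 (hinj : Function.Injective lam) (hlam : ∀ j, -1 / 2 < lam j)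
    (x : Lp ℝ 2 halfLine) (t : ℝ≥0) :
    IntegrableOn (fun s : ℝ => ⟪x, kernelL2 hlam s.toNNReal⟫_ℝ) (Ioc (0 : ℝ) t) := by
  refine IntegrableOn.congr_fun (f := fun s => ∫ v, x v * muntzKernel lam s v ∂halfLine) ?_
    (fun s hs => (inner_kernelL2_eq_integral hlam x hs.1).symm) measurableSet_Ioc
  exact integrable_integral_mul_of_lintegral_eLpNorm (measurable_uncurry_muntzKernel lam)
    (lintegral_eLpNorm_muntzKernel_ne_top hinj hlam t) (Lp.memLp x)

theorem inner_primitiveL2 (hinj : Function.Injective lam) (hlam : ∀ j, -1 / 2 < lam j)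
    (x : Lp ℝ 2 halfLine) (t : ℝ≥0) :
    ⟪x, primitiveL2 hinj hlam t⟫_ℝ =
      ∫ s in Ioc (0 : ℝ) t, ⟪x, kernelL2 hlam s.toNNReal⟫_ℝ := by
  rw [setIntegral_congr_fun measurableSet_Ioc
    fun s hs => inner_kernelL2_eq_integral hlam x hs.1,
    ← integral_mul_integral_of_lintegral_eLpNorm (measurable_uncurry_muntzKernel lam)
      (lintegral_eLpNorm_muntzKernel_ne_top hinj hlam t) (Lp.memLp x), inner_eq_integral_mul]
  refine integral_congr_ae ?_
  filter_upwards [coeFn_primitiveL2 hinj hlam t] with v hv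
  rw [hv]

/-- `1_{(0,t]} - ∫_0^t k_n(s,·) ds`, whose Wiener integral is the value at `t` of the transform. -/
noncomputable def transformL2 (hinj : Function.Injective lam) (hlam : ∀ j, -1 / 2 < lam j)
    (t : ℝ≥0) : Lp ℝ 2 halfLine :=
  oneL2 t - primitiveL2 hinj hlam t

theorem inner_transformL2_kernelL2 (hinj : Function.Injective lam) (hlam : ∀ j, -1 / 2 < lam j)
    (t : ℝ≥0) : ∀ᵐ u ∂volume.restrict (Ioc (0 : ℝ) t),
      ⟪transformL2 hinj hlam t, kernelL2 hlam u.toNNReal⟫_ℝ =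
        -∫ w in Ioc (0 : ℝ) t, muntzKernel lam w u := by
  have hint := ae_restrict_Ioc_of_ae_halfLine (ae_integrable_of_lintegral_eLpNorm
    (measurable_uncurry_muntzKernel lam) (lintegral_eLpNorm_muntzKernel_ne_top hinj hlam t)) t
  filter_upwards [hint, ae_restrict_mem measurableSet_Ioc] with u hu hut
  have hu0 : 0 < u.toNNReal := Real.toNNReal_pos.2 hut.1
  have hk := ae_restrict_Ioc_of_ae_halfLine (coeFn_kernelL2 hlam u.toNNReal) t
  rw [Real.coe_toNNReal u hut.1.le] at hk
  have hku : IntegrableOn (muntzKernel lam u) (Ioc (0 : ℝ) t) :=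
    (integrableOn_coeFn (kernelL2 hlam u.toNNReal) t).congr hk
  have h1 : ⟪oneL2 t, kernelL2 hlam u.toNNReal⟫_ℝ = ∫ w in Ioc (0 : ℝ) t, muntzKernel lam u w := by
    rw [inner_oneL2]
    exact integral_congr_ae hk
  -- For w ≠ u exactly one of the two kernel values can be nonzero, and it equals the inner product
  -- of the two kernels.
  have h2 : ⟪kernelL2 hlam u.toNNReal, primitiveL2 hinj hlam t⟫_ℝ =
      ∫ w in Ioc (0 : ℝ) t, (muntzKernel lam u w + muntzKernel lam w u) := by
    rw [inner_primitiveL2]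
    have hne : ∀ᵐ w : ℝ, w ≠ u := by simp [ae_iff]
    refine setIntegral_congr_ae measurableSet_Ioc ?_
    filter_upwards [hne] with w hwu hw
    have hw0 : 0 < w.toNNReal := Real.toNNReal_pos.2 hw.1
    rcases lt_or_gt_of_ne hwu with h | h
    · rw [inner_kernelL2_kernelL2 hinj hlam hw0 (Real.toNNReal_le_toNNReal h.le),
        Real.coe_toNNReal _ hut.1.le, Real.coe_toNNReal _ hw.1.le,
        show muntzKernel lam w u = 0 from if_neg h.not_ge, add_zero]
    · rw [real_inner_comm, inner_kernelL2_kernelL2 hinj hlam hu0 (Real.toNNReal_le_toNNReal h.le),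
        Real.coe_toNNReal _ hut.1.le, Real.coe_toNNReal _ hw.1.le,
        show muntzKernel lam u w = 0 from if_neg h.not_ge, zero_add]
  rw [transformL2, inner_sub_left, h1, real_inner_comm, h2, integral_add hku hu]
  ring

/-- With p_t = ∫_0^t k_n(u,·) du, integrating `inner_transformL2_kernelL2` over u ≤ s gives ⟨x_t,
p_s⟩ = -⟨1_{(0,s]}, p_t⟩. This cancels the other cross term in ⟨x_t, 1_{(0,s]} - p_s⟩ and leaves
⟨1_{(0,t]}, 1_{(0,s]}⟩ = s. -/
theorem inner_transformL2 (hinj : Function.Injective lam) (hlam : ∀ j, -1 / 2 < lam j)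
    {s t : ℝ≥0} (hst : s ≤ t) :
    ⟪transformL2 hinj hlam s, transformL2 hinj hlam t⟫_ℝ = s := by
  have hsub : Ioc (0 : ℝ) s ⊆ Ioc (0 : ℝ) t :=
    Ioc_subset_Ioc_right (by exact_mod_cast hst)
  have h1 : ⟪transformL2 hinj hlam t, primitiveL2 hinj hlam s⟫_ℝ =
      -⟪oneL2 s, primitiveL2 hinj hlam t⟫_ℝ := by
    rw [inner_primitiveL2, inner_oneL2, ← integral_neg]
    refine integral_congr_ae ?_
    filter_upwards [ae_restrict_of_ae_restrict_of_subset hsub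
      (inner_transformL2_kernelL2 hinj hlam t),
      ae_restrict_Ioc_of_ae_halfLine (coeFn_primitiveL2 hinj hlam t) s] with u h1 h2
    rw [h1, h2]
  rw [real_inner_comm]
  nth_rw 2 [transformL2]
  rw [inner_sub_right, h1, transformL2, inner_sub_left, inner_oneL2_oneL2, min_eq_right hst,
    real_inner_comm (oneL2 s)]
  ring

theorem inner_powL2_transformL2 (hinj : Function.Injective lam) (hlam : ∀ j, -1 / 2 < lam j)
    {s t : ℝ≥0} (hst : s ≤ t) (i : Fin n) :
    ⟪powL2 t (hlam i), transformL2 hinj hlam s⟫_ℝ = 0 := by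
  rw [transformL2, inner_sub_right, inner_primitiveL2, real_inner_comm, powL2,
    inner_oneL2_trunc hst, sub_eq_zero]
  refine setIntegral_congr_fun measurableSet_Ioc fun u hu => ?_
  have h := inner_powL2_kernelL2 hinj hlam (Real.toNNReal_pos.2 hu.1)
    (Real.toNNReal_le_iff_le_coe.2 (hu.2.trans (by exact_mod_cast hst)) : u.toNNReal ≤ t) i
  rw [Real.coe_toNNReal _ hu.1.le] at h
  exact h.symm

/-! ### The function `ρ_n` -/

theorem continuousOn_muntzK_inv_div (lam : Fin n → ℝ) :
    ContinuousOn (fun r : ℝ => muntzK lam (1 / r) / r) (Ioi 0) := by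
  unfold muntzK
  refine ContinuousOn.div (continuousOn_finsetSum _ fun j _ => continuousOn_const.mul ?_)
    continuousOn_id fun r hr => (ne_of_gt hr)
  refine ContinuousOn.rpow_const (continuousOn_const.div continuousOn_id fun r hr => ne_of_gt hr)
    fun r hr => Or.inl ?_
  have hr : 0 < r := hr
  positivity

theorem setIntegral_muntzKernel {t v : ℝ} (hv : 0 < v) (hvt : v ≤ t) :
    ∫ s in Ioc (0 : ℝ) t, muntzKernel lam s v = 1 - muntzRho lam (t / v) := by
  have h1 : ∫ s in Ioc (0 : ℝ) t, muntzKernel lam s v =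
      ∫ s in Ioc v t, s⁻¹ * muntzK lam (v / s) := by
    rw [← integral_indicator measurableSet_Ioc, ← integral_indicator measurableSet_Ioc]
    refine integral_congr_ae ?_
    have hne : ∀ᵐ s : ℝ, s ≠ v := by simp [ae_iff]
    filter_upwards [hne] with s hs
    simp only [indicator, mem_Ioc, muntzKernel]
    grind
  -- Substitution s = v r, which turns the range [v,t] into [1,t/v].
  have h2 := intervalIntegral.integral_comp_mul_left (a := 1) (b := t / v)
    (fun s => s⁻¹ * muntzK lam (v / s)) hv.ne'
  rw [mul_one, mul_div_cancel₀ _ hv.ne', eq_inv_smul_iff₀ hv.ne'] at h2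
  rw [h1, ← intervalIntegral.integral_of_le hvt, ← h2, muntzRho, sub_sub_cancel, smul_eq_mul,
    ← intervalIntegral.integral_const_mul]
  refine intervalIntegral.integral_congr fun r _ => ?_
  rw [← div_div, div_self hv.ne', mul_inv]
  field_simp

theorem setIntegral_muntzKernel_of_lt {t v : ℝ} (hvt : t < v) :
    ∫ s in Ioc (0 : ℝ) t, muntzKernel lam s v = 0 := by
  refine setIntegral_eq_zero_of_forall_eq_zero fun s hs => if_neg ?_
  exact not_le.2 (hs.2.trans_lt hvt)

theorem coeFn_transformL2 (hinj : Function.Injective lam) (hlam : ∀ j, -1 / 2 < lam j)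
    (t : ℝ≥0) : transformL2 hinj hlam t =ᵐ[halfLine]
      (Ioc (0 : ℝ) t).indicator fun v => muntzRho lam (t / v) := by
  filter_upwards [coeFn_sub_of_ae (coeFn_oneL2 t) (coeFn_primitiveL2 hinj hlam t),
    ae_restrict_mem measurableSet_Ioi] with v hv h0
  rw [transformL2, hv]
  by_cases h : v ≤ t
  · have h1 : v ∈ Ioc (0 : ℝ) t := ⟨h0, h⟩
    rw [indicator_of_mem h1, indicator_of_mem h1, setIntegral_muntzKernel h0 h]
    ring
  · have h1 : v ∉ Ioc (0 : ℝ) t := fun h' => h h'.2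
    rw [indicator_of_notMem h1, indicator_of_notMem h1,
      setIntegral_muntzKernel_of_lt (not_le.1 h), sub_zero]

theorem memL2_muntzRho (hinj : Function.Injective lam) (hlam : ∀ j, -1 / 2 < lam j) (t : ℝ≥0) :
    MemL2 t fun s => muntzRho lam (t / s) := by
  refine (memLp_congr_ae ?_).1 (memL2_coeFn (transformL2 hinj hlam t) t)
  filter_upwards [ae_restrict_Ioc_of_ae_halfLine (coeFn_transformL2 hinj hlam t) t,
    ae_restrict_mem measurableSet_Ioc] with v hv h
  rw [hv, indicator_of_mem h]

theorem trunc_muntzRho (hinj : Function.Injective lam) (hlam : ∀ j, -1 / 2 < lam j) (t : ℝ≥0) :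
    trunc t (memL2_muntzRho hinj hlam t) = transformL2 hinj hlam t :=
  Lp.ext ((coeFn_trunc t _).trans (coeFn_transformL2 hinj hlam t).symm)

theorem memClassM_muntzRho (hinj : Function.Injective lam) (hlam : ∀ j, -1 / 2 < lam j) :
    MemClassM (muntzRho lam) := by
  constructor
  · have hc : ContinuousOn (muntzRho lam) (Ici 1) := by
      refine continuousOn_const.sub fun x hx => ContinuousAt.continuousWithinAt ?_
      have hx0 : 0 < x := lt_of_lt_of_le one_pos hx
      have hK := continuousOn_muntzK_inv_div lam
      refine (intervalIntegral.integral_hasDerivAt_right ?_ ?_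
        (hK.continuousAt (Ioi_mem_nhds hx0))).continuousAt
      · refine (hK.mono fun y hy => ?_).intervalIntegrable
        rw [uIcc_of_le hx] at hy
        exact lt_of_lt_of_le one_pos hy.1
      · exact hK.stronglyMeasurableAtFilter isOpen_Ioi x hx0
    exact hc.domRestrict.measurable
  · have h := (memL2_muntzRho hinj hlam 1).integrable_sq
    simpa [IntegrableOn] using h

theorem memL2_muntzKernel (hlam : ∀ j, -1 / 2 < lam j) (s : ℝ≥0) : MemL2 s (muntzKernel lam s) :=
  (memLp_congr_ae (ae_restrict_Ioc_of_ae_halfLine (coeFn_kernelL2 hlam s) s)).1 (memL2_coeFn _ s)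

theorem isVolterraKernel_muntzKernel (hinj : Function.Injective lam)
    (hlam : ∀ j, -1 / 2 < lam j) : IsVolterraKernel (muntzKernel lam) where
  eq_zero s v _ h := if_neg h.not_ge
  continuousOn_symm := by
    -- The symmetrized kernel is max⁻¹ K_n(min/max), visibly continuous off the axes.
    have h : ContinuousOn (fun p : ℝ × ℝ => (max p.1 p.2)⁻¹ *
        muntzK lam (min p.1 p.2 / max p.1 p.2)) (Ioi 0 ×ˢ Ioi 0) := by
      have hmax : ∀ p ∈ (Ioi 0 ×ˢ Ioi 0 : Set (ℝ × ℝ)), max p.1 p.2 ≠ 0 := fun p hp =>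
        (lt_max_of_lt_left hp.1).ne'
      have hcmax : ContinuousOn (fun p : ℝ × ℝ => max p.1 p.2) (Ioi 0 ×ˢ Ioi 0) := by fun_prop
      unfold muntzK
      refine (hcmax.inv₀ hmax).mul
        (continuousOn_finsetSum _ fun j _ => continuousOn_const.mul ?_)
      refine ContinuousOn.rpow_const (ContinuousOn.div (by fun_prop) hcmax hmax)
        fun p hp => Or.inl ?_
      exact (div_pos (lt_min hp.1 hp.2) (lt_max_of_lt_left hp.1)).ne'
    refine h.congr fun p _ => ?_
    rcases le_or_gt p.2 p.1 with h | h
    · simp [muntzKernel, h]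
    · simp [muntzKernel, h.le, h.not_ge]
  memL2 u _ := memL2_muntzKernel hlam u
  integrable t := by
    refine IntegrableOn.congr_fun (f := fun u : ℝ => √(muntzK lam 1) * u ^ (-1 / 2 : ℝ))
      ((integrableOn_Ioc_rpow (by norm_num) t).const_mul _) (fun u hu => ?_) measurableSet_Ioc
    have hu0 : 0 < u.toNNReal := Real.toNNReal_pos.2 hu.1
    have h := norm_kernelL2 hinj hlam hu0
    rw [Real.coe_toNNReal u hu.1.le] at h
    simp only
    rw [← h, norm_eq_sqrt_real_inner, inner_kernelL2_eq_integral hlam _ hu.1,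
      intervalIntegral.integral_of_le hu.1.le, ← Real.coe_toNNReal u hu.1.le,
      ← integral_halfLine_indicator, Real.coe_toNNReal u hu.1.le]
    congr 1
    refine integral_congr_ae ?_
    have hk := coeFn_kernelL2 hlam u.toNNReal
    rw [Real.coe_toNNReal u hu.1.le] at hk
    filter_upwards [hk, ae_restrict_mem measurableSet_Ioi] with v hv hv0
    rw [hv]
    by_cases hvu : v ≤ u
    · rw [indicator_of_mem (show v ∈ Ioc 0 u from ⟨hv0, hvu⟩), sq]
    · rw [indicator_of_notMem fun h' => hvu h'.2, muntzKernel, if_neg hvu, zero_mul]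

end Kernel

/-! ### The orthogonal complement of the transformed indicators -/

section Complement

variable {n : ℕ} {lam : Fin n → ℝ}

/-- The moments J_j satisfy J_j' = u^{λ_j} ∑_k a_k u^{-(λ_k+1)} J_k. In the eigenbasis given by the
inverse Cauchy matrix the system decouples into first integrals w_i, which become the coefficients
of u^{λ_i}. -/
theorem exists_eq_sum_rpow (hinj : Function.Injective lam) (hlam : ∀ j, -1 / 2 < lam j)
    {t : ℝ≥0} {g : ℝ → ℝ}
    (hint : ∀ j, IntegrableOn (fun v => v ^ lam j * g v) (Ioc (0 : ℝ) t))
    (hg : ∀ᵐ u ∂volume.restrict (Ioc (0 : ℝ) t), g u =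
      ∑ j, muntzCoeff lam j * u ^ (-(lam j + 1)) * ∫ v in (0 : ℝ)..u, v ^ lam j * g v) :
    ∃ c : Fin n → ℝ, ∀ᵐ u ∂volume.restrict (Ioc (0 : ℝ) t), g u = ∑ i, c i * u ^ lam i := by
  obtain ⟨D, -, hCD, hD⟩ := exists_inverse_cauchy hinj hlam
  set J : Fin n → ℝ → ℝ := fun j u => ∫ v in (0 : ℝ)..u, v ^ lam j * g v with hJ
  -- A continuous representative of g on (0,t). Replacing g by h inside J_j makes J_j differentiable
  -- at every point, not just almost everywhere.
  set h : ℝ → ℝ := fun u => ∑ j, muntzCoeff lam j * u ^ (-(lam j + 1)) * J j u with hh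
  have hii (j : Fin n) : IntervalIntegrable (fun v => v ^ lam j * g v) volume 0 t :=
    (intervalIntegrable_iff_integrableOn_Ioc_of_le t.coe_nonneg).2 (hint j)
  have hJc (j : Fin n) : ContinuousOn (J j) (Ioo (0 : ℝ) t) := by
    refine (intervalIntegral.continuousOn_primitive_interval' (hii j) left_mem_uIcc).mono ?_
    rw [uIcc_of_le t.coe_nonneg]
    exact Ioo_subset_Icc_self
  have hhc : ContinuousOn h (Ioo (0 : ℝ) t) :=
    continuousOn_finsetSum _ fun j _ => (continuousOn_const.mul
      (continuousOn_id.rpow_const fun u hu => Or.inl hu.1.ne')).mul (hJc j)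
  have hJd (j : Fin n) {u : ℝ} (hu : u ∈ Ioo (0 : ℝ) t) :
      HasDerivAt (J j) (u ^ lam j * h u) u := by
    have hc : ContinuousOn (fun v => v ^ lam j * h v) (Ioo (0 : ℝ) t) :=
      (continuousOn_id.rpow_const fun u hu => Or.inl hu.1.ne').mul hhc
    have hae {x : ℝ} (hx : x ∈ Ioo (0 : ℝ) t) :
        (fun v => v ^ lam j * g v) =ᵐ[volume.restrict (Ioc 0 x)] fun v => v ^ lam j * h v := by
      filter_upwards [ae_restrict_of_ae_restrict_of_subset (Ioc_subset_Ioc_right hx.2.le) hg]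
        with v hv
      rw [hv]
    have hd := intervalIntegral.integral_hasDerivAt_right (f := fun v => v ^ lam j * h v) (a := 0)
      (b := u) ((intervalIntegrable_iff_integrableOn_Ioc_of_le hu.1.le).2
        (((hint j).mono_set (Ioc_subset_Ioc_right hu.2.le)).congr (hae hu)))
      (hc.stronglyMeasurableAtFilter isOpen_Ioo u hu) (hc.continuousAt (isOpen_Ioo.mem_nhds hu))
    refine hd.congr_of_eventuallyEq ?_
    filter_upwards [isOpen_Ioo.mem_nhds hu] with x hx
    simp only [hJ]
    rw [intervalIntegral.integral_of_le hx.1.le, intervalIntegral.integral_of_le hx.1.le]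
    exact integral_congr_ae (hae hx)
  set w : Fin n → ℝ → ℝ := fun i u => ∑ j, D i j * (u ^ (-(lam i + lam j + 1)) * J j u) with hw
  have hwd (i : Fin n) {u : ℝ} (hu : u ∈ Ioo (0 : ℝ) t) : HasDerivAt (w i) 0 u := by
    have hu0 : 0 < u := hu.1
    have h1 : HasDerivAt (w i) (∑ j, D i j *
        ((-(lam i + lam j + 1)) * u ^ (-(lam i + lam j + 1) - 1) * J j u +
          u ^ (-(lam i + lam j + 1)) * (u ^ lam j * h u))) u := by
      refine HasDerivAt.fun_sum fun j _ => HasDerivAt.const_mul _ ?_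
      exact (Real.hasDerivAt_rpow_const (Or.inl hu0.ne')).mul (hJd j hu)
    convert h1 using 1
    have h2 (k : Fin n) : u ^ (-(lam i + lam k + 1) - 1) =
        u ^ (-(lam i + 1)) * u ^ (-(lam k + 1)) := by
      rw [← Real.rpow_add hu0]
      ring_nf
    have h3 (k : Fin n) : u ^ (-(lam i + lam k + 1)) * (u ^ lam k * h u) =
        u ^ (-(lam i + 1)) * h u := by
      rw [← mul_assoc, ← Real.rpow_add hu0]
      ring_nf
    simp only [h2, h3, mul_add, Finset.sum_add_distrib]
    rw [← Finset.sum_mul, hh]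
    simp only [Finset.mul_sum]
    rw [← Finset.sum_add_distrib]
    refine (Finset.sum_eq_zero fun k _ => ?_).symm
    -- The coefficient of each J_k vanishes by the row-eigenvector relation for the inverse Cauchy
    -- matrix.
    linear_combination (u ^ (-(lam i + 1)) * u ^ (-(lam k + 1)) * J k u) * hD i k
  -- Any point of (0,t) would do, since w_i is constant there.
  refine ⟨fun i => w i (t / 2), ?_⟩
  have hne : ∀ᵐ u : ℝ, u ≠ t := by simp [ae_iff]
  filter_upwards [hg, ae_restrict_mem measurableSet_Ioc, ae_restrict_of_ae hne] with u hgu hut hune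
  have hu : u ∈ Ioo (0 : ℝ) t := ⟨hut.1, lt_of_le_of_ne hut.2 hune⟩
  have hu0 : 0 < u := hu.1
  have ht2 : (t / 2 : ℝ) ∈ Ioo (0 : ℝ) t := by
    have : (0 : ℝ) < t := hu.1.trans hu.2
    constructor <;> linarith
  have hconst (i : Fin n) : w i (t / 2) = w i u :=
    isOpen_Ioo.is_const_of_deriv_eq_zero isPreconnected_Ioo
      (fun x hx => (hwd i hx).differentiableAt.differentiableWithinAt)
      (fun x hx => (hwd i hx).deriv) ht2 hu
  -- Recovers the moments from the first integrals by multiplying with the Cauchy matrix.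
  have hJw (k : Fin n) : u ^ (-(lam k + 1)) * J k u =
      ∑ i, 1 / (lam i + lam k + 1) * (w i u * u ^ lam i) := by
    have h4 (i : Fin n) : w i u * u ^ lam i = ∑ j, D i j * (u ^ (-(lam j + 1)) * J j u) := by
      rw [hw, Finset.sum_mul]
      refine Finset.sum_congr rfl fun j _ => ?_
      rw [show -(lam j + 1) = -(lam i + lam j + 1) + lam i by ring, Real.rpow_add hu0]
      ring
    simp only [h4, Finset.mul_sum]
    rw [Finset.sum_comm]
    have h5 (j : Fin n) : ∑ i, 1 / (lam i + lam k + 1) * (D i j * (u ^ (-(lam j + 1)) * J j u)) =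
        (1 : Matrix (Fin n) (Fin n) ℝ) k j * (u ^ (-(lam j + 1)) * J j u) := by
      rw [← hCD, Matrix.mul_apply, Finset.sum_mul]
      refine Finset.sum_congr rfl fun i _ => ?_
      rw [Matrix.of_apply]
      ring
    rw [Finset.sum_congr rfl fun j _ => h5 j]
    simp [Matrix.one_apply]
  simp only [hconst]
  calc g u = ∑ k, muntzCoeff lam k * (u ^ (-(lam k + 1)) * J k u) := by
        rw [hgu]
        exact Finset.sum_congr rfl fun k _ => mul_assoc _ _ _
    _ = ∑ i, ∑ k, muntzCoeff lam k * (1 / (lam i + lam k + 1)) * (w i u * u ^ lam i) := by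
        simp only [hJw, Finset.mul_sum]
        rw [Finset.sum_comm]
        simp only [mul_assoc]
    _ = ∑ i, w i u * u ^ lam i := by
        refine Finset.sum_congr rfl fun i _ => ?_
        have := sum_muntzCoeff_div hinj hlam i
        simp_rw [add_comm (lam i)]
        rw [← Finset.sum_mul, this, one_mul]

theorem inner_kernelL2_eq_sum (hlam : ∀ j, -1 / 2 < lam j) (x : Lp ℝ 2 halfLine) {u : ℝ}
    (hu : 0 < u) : ⟪x, kernelL2 hlam u.toNNReal⟫_ℝ =
      ∑ j, muntzCoeff lam j * u ^ (-(lam j + 1)) * ∫ v in (0 : ℝ)..u, v ^ lam j * x v := by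
  simp only [kernelL2, inner_sum, inner_smul_right]
  refine Finset.sum_congr rfl fun j _ => ?_
  rw [real_inner_comm, powL2, inner_trunc, intervalIntegral.integral_of_le hu.le,
    Real.coe_toNNReal u hu.le]

theorem mem_span_powL2_of_orthogonal (hinj : Function.Injective lam) (hlam : ∀ j, -1 / 2 < lam j)
    {t : ℝ≥0} {x : Lp ℝ 2 halfLine} (hx : x ∈ spanUpTo t)
    (horth : ∀ s ≤ t, ⟪x, transformL2 hinj hlam s⟫_ℝ = 0) :
    x ∈ Submodule.span ℝ (range fun j => powL2 t (hlam j)) := by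
  have hi1 := integrableOn_coeFn x t
  have hi2 := integrableOn_inner_kernelL2 hinj hlam x t
  have hae : ∀ᵐ u ∂volume.restrict (Ioc (0 : ℝ) t),
      x u - ⟪x, kernelL2 hlam u.toNNReal⟫_ℝ = 0 := by
    refine ae_eq_zero_of_forall_setIntegral_Ioc (hi1.sub hi2) fun s hs => ?_
    have hsub : Ioc (0 : ℝ) s ⊆ Ioc (0 : ℝ) t := Ioc_subset_Ioc_right (by exact_mod_cast hs)
    have h := horth s hs
    rwa [transformL2, inner_sub_right, inner_primitiveL2, real_inner_comm, inner_oneL2,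
      ← integral_sub (hi1.mono_set hsub) (hi2.mono_set hsub)] at h
  obtain ⟨c, hc⟩ := exists_eq_sum_rpow hinj hlam (t := t) (g := x)
    (fun j => (memL2_rpow t (hlam j)).integrable_mul (memL2_coeFn x t)) (by
      filter_upwards [hae, ae_restrict_mem measurableSet_Ioc] with u hu hut
      rw [← inner_kernelL2_eq_sum hlam x hut.1]
      exact sub_eq_zero.1 hu)
  set y : Lp ℝ 2 halfLine := ∑ i, c i • powL2 t (hlam i) with hy
  have hyV : y ∈ spanUpTo t :=
    Submodule.sum_mem _ fun i _ => Submodule.smul_mem _ _ (trunc_mem_spanUpTo t _)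
  -- Equality with y is known only on (0,t]. As x and y both lie in `spanUpTo t`, a difference that
  -- is also orthogonal to that space must be zero.
  have hd : x - y ∈ (spanUpTo t)ᗮ := by
    refine mem_orthogonal_spanUpTo.2 fun s hs => ?_
    have hsub : Ioc (0 : ℝ) s ⊆ Ioc (0 : ℝ) t := Ioc_subset_Ioc_right (by exact_mod_cast hs)
    refine integral_eq_zero_of_ae (ae_restrict_of_ae_restrict_of_subset hsub ?_)
    have hyc : y =ᵐ[halfLine] fun v => ∑ i, c i * (Ioc (0 : ℝ) t).indicator (· ^ lam i) v :=
      coeFn_finset_sum _ _ fun i _ => coeFn_smul_of_ae (c i) (coeFn_trunc t _)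
    filter_upwards [hc, ae_restrict_Ioc_of_ae_halfLine
      (coeFn_sub_of_ae (ae_eq_refl x) hyc) t, ae_restrict_mem measurableSet_Ioc] with v h1 h2 h3
    rw [h2, h1]
    simp [indicator_of_mem h3]
  have hxy : x - y = 0 := by
    have h0 := (Submodule.mem_orthogonal _ _).1 hd _ (Submodule.sub_mem _ hx hyV)
    exact inner_self_eq_zero.1 h0
  rw [sub_eq_zero.1 hxy]
  exact Submodule.sum_mem _ fun i _ => Submodule.smul_mem _ _ (Submodule.subset_span ⟨i, rfl⟩)

/-- The Gram matrix of the powers in L²(0,1] is the Cauchy matrix, which is invertible. -/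
theorem linIndepAE_rpow (hinj : Function.Injective lam) (hlam : ∀ j, -1 / 2 < lam j) :
    LinIndepAE fun j s => s ^ lam j := by
  intro c hc
  obtain ⟨D, hDC, -, -⟩ := exists_inverse_cauchy hinj hlam
  have hC : (Matrix.of fun j i => 1 / (lam i + lam j + 1)).mulVec c = 0 := by
    ext j
    have h1 : (∑ i, c i • powL2 1 (hlam i) : Lp ℝ 2 halfLine) = 0 := by
      rw [Lp.eq_zero_iff_ae_eq_zero]
      refine (coeFn_finset_sum _ _ fun i _ => coeFn_smul_of_ae (c i) (coeFn_trunc 1 _)).trans ?_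
      filter_upwards [hc] with v hv
      by_cases h : v ∈ Ioc (0 : ℝ) (1 : ℝ≥0)
      · simpa only [indicator_of_mem h, Pi.zero_apply] using hv
      · simp only [indicator_of_notMem h, mul_zero, Finset.sum_const_zero, Pi.zero_apply]
    have h2 : ⟪powL2 1 (hlam j), ∑ i, c i • powL2 1 (hlam i)⟫_ℝ = 0 := by rw [h1, inner_zero_right]
    simp only [inner_sum, inner_smul_right, inner_powL2_powL2 le_rfl, NNReal.coe_one,
      Real.one_rpow] at h2
    rw [Pi.zero_apply, ← h2, Matrix.mulVec, dotProduct]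
    refine Finset.sum_congr rfl fun i _ => ?_
    rw [Matrix.of_apply, mul_comm, add_comm (lam i)]
  calc c = (1 : Matrix (Fin n) (Fin n) ℝ).mulVec c := (Matrix.one_mulVec c).symm
    _ = 0 := by rw [← hDC, ← Matrix.mulVec_mulVec, hC, Matrix.mulVec_zero]

end Complement

/-! ### Gaussian spaces -/

section GaussianSpace

variable {W : Lp ℝ 2 halfLine →ₗᵢ[ℝ] Lp ℝ 2 P}

/-- An isometry of a complete space is a closed embedding, so it commutes with closed linear spans.
-/
theorem gaussianSpace_eq_map {X : ℝ≥0 → Ω → ℝ} {x : ℝ≥0 → Lp ℝ 2 halfLine}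
    (hX : ∀ s, X s =ᵐ[P] W (x s)) (t : ℝ≥0) : gaussianSpace P X t =
      (Submodule.span ℝ (x '' Iic t)).topologicalClosure.map W.toLinearMap := by
  have hset : {Z : Lp ℝ 2 P | ∃ s ≤ t, Z =ᵐ[P] X s} = W.toLinearMap '' (x '' Iic t) := by
    ext Z
    simp only [mem_ofPred_eq, mem_image, mem_Iic, exists_exists_and_eq_and]
    refine exists_congr fun s => and_congr_right fun _ => ⟨fun h => ?_, fun h => ?_⟩
    · exact (Lp.ext (h.trans (hX s))).symm
    · rw [← h]
      exact (hX s).symm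
  rw [gaussianSpace, hset, ← Submodule.map_span]
  refine le_antisymm (Submodule.topologicalClosure_minimal _
    (Submodule.map_mono (Submodule.le_topologicalClosure _)) ?_) ?_
  · rw [Submodule.map_coe]
    exact W.isometry.isClosedEmbedding.isClosedMap _ (Submodule.isClosed_topologicalClosure _)
  · rw [← SetLike.coe_subset_coe, Submodule.map_coe, Submodule.topologicalClosure_coe,
      Submodule.topologicalClosure_coe, Submodule.map_coe]
    exact image_closure_subset_closure_image W.continuous

theorem wienerSpan_eq_map {B : ℝ≥0 → Ω → ℝ} (hW : ∀ s, W (oneL2 s) =ᵐ[P] B s) {t : ℝ≥0} {n : ℕ}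
    {g : Fin n → ℝ → ℝ} (hg : ∀ j, MemL2 t (g j)) :
    wienerSpan P B g t =
      (Submodule.span ℝ (range fun j => trunc t (hg j))).map W.toLinearMap := by
  rw [wienerSpan, Submodule.map_span]
  congr 1
  ext Z
  simp only [mem_ofPred_eq, isWienerIntegral_iff hW (hg _), mem_image, mem_range,
    exists_exists_eq_and]
  refine exists_congr fun j => ⟨fun h => (Lp.ext h).symm, fun h => ?_⟩
  rw [← h]
  rfl

variable {n : ℕ} {lam : Fin n → ℝ}

theorem gaussianSpace_transform {B T : ℝ≥0 → Ω → ℝ} (hW : ∀ s, W (oneL2 s) =ᵐ[P] B s)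
    (hinj : Function.Injective lam) (hlam : ∀ j, -1 / 2 < lam j)
    (hT : ∀ s, T s =ᵐ[P] W (transformL2 hinj hlam s)) (t : ℝ≥0) :
    gaussianSpace P T t ≤ gaussianSpace P B t ∧
      (gaussianSpace P T t)ᗮ ⊓ gaussianSpace P B t = muntzGaussianSpace P B lam t := by
  rw [gaussianSpace_eq_map hT, gaussianSpace_eq_map (fun s => (hW s).symm), muntzGaussianSpace,
    wienerSpan_eq_map hW fun j => memL2_rpow t (hlam j)]
  have hle : (Submodule.span ℝ (transformL2 hinj hlam '' Iic t)).topologicalClosure ≤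
      spanUpTo t := by
    refine Submodule.topologicalClosure_minimal _ (Submodule.span_le.2 ?_)
      (Submodule.isClosed_topologicalClosure _)
    rintro _ ⟨s, hs, rfl⟩
    rw [← trunc_muntzRho]
    refine Submodule.topologicalClosure_mono (Submodule.span_mono ?_) (trunc_mem_spanUpTo s _)
    exact image_mono (Iic_subset_Iic.2 hs)
  refine ⟨Submodule.map_mono hle, le_antisymm ?_ ?_⟩
  · rintro _ ⟨hZ, x, hx, rfl⟩
    refine ⟨x, mem_span_powL2_of_orthogonal hinj hlam hx fun s hs => ?_, rfl⟩
    have h := (Submodule.mem_orthogonal' _ _).1 hZ (W (transformL2 hinj hlam s))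
      (Submodule.mem_map_of_mem (f := W.toLinearMap)
        (Submodule.le_topologicalClosure _ (Submodule.subset_span ⟨s, hs, rfl⟩)))
    rwa [LinearIsometry.coe_toLinearMap, W.inner_map_map] at h
  · rw [Submodule.map_le_iff_le_comap, Submodule.span_le]
    rintro _ ⟨j, rfl⟩
    refine ⟨?_, Submodule.mem_map_of_mem (trunc_mem_spanUpTo t _)⟩
    rw [SetLike.mem_coe, Submodule.mem_orthogonal']
    rintro _ ⟨y, hy, rfl⟩
    rw [LinearIsometry.coe_toLinearMap, W.inner_map_map]
    have hc : y ∈ (Submodule.span ℝ {powL2 t (hlam j)})ᗮ := by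
      refine Submodule.topologicalClosure_minimal _ (Submodule.span_le.2 ?_)
        (Submodule.isClosed_orthogonal _) hy
      rintro _ ⟨s, hs, rfl⟩
      exact Submodule.mem_orthogonal_singleton_iff_inner_right.2
        (inner_powL2_transformL2 hinj hlam hs j)
    exact Submodule.mem_orthogonal_singleton_iff_inner_right.1 hc

theorem isOrthogonalSum_transform {B T : ℝ≥0 → Ω → ℝ} (hW : ∀ s, W (oneL2 s) =ᵐ[P] B s)
    (hinj : Function.Injective lam) (hlam : ∀ j, -1 / 2 < lam j)
    (hT : ∀ s, T s =ᵐ[P] W (transformL2 hinj hlam s)) (t : ℝ≥0) :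
    IsOrthogonalSum (gaussianSpace P B t) (gaussianSpace P T t)
      (muntzGaussianSpace P B lam t) := by
  obtain ⟨hle, heq⟩ := gaussianSpace_transform hW hinj hlam hT t
  have hc : IsClosed (gaussianSpace P T t : Set (Lp ℝ 2 P)) :=
    Submodule.isClosed_topologicalClosure _
  have : CompleteSpace (gaussianSpace P T t) := hc.completeSpace_coe
  rw [← heq]
  exact ⟨(Submodule.isOrtho_orthogonal_right _).mono_right inf_le_left,
    Submodule.sup_orthogonal_inf_of_hasOrthogonalProjection hle⟩

end GaussianSpace

/-! ### Jointly measurable versions -/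

/-- Discretize time to ⌊sk⌋/k, use measurable modifications at these countably many times, and
recover B_s by path continuity. The limsup keeps the result measurable on the null set without
convergence. -/
theorem exists_measurable_version {B : ℝ≥0 → Ω → ℝ} (hB : IsBrownianReal B P) :
    ∃ B' : ℝ → Ω → ℝ, Measurable (Function.uncurry B') ∧
      ∀ᵐ ω ∂P, ∀ s : ℝ≥0, B' s ω = B s ω := by
  let q (k m : ℕ) : ℝ≥0 := m / (k : ℝ≥0)
  let b (k m : ℕ) : Ω → ℝ := (hB.aemeasurable (q k m)).mk (B (q k m))
  have hb : ∀ᵐ ω ∂P, ∀ k m, b k m ω = B (q k m) ω :=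
    ae_all_iff.2 fun k => ae_all_iff.2 fun m => (hB.aemeasurable (q k m)).ae_eq_mk.symm
  refine ⟨fun s ω => limsup (fun k : ℕ => b k ⌊s * k⌋₊ ω) atTop, ?_, ?_⟩
  · refine Measurable.limsup (f := fun (k : ℕ) (p : ℝ × Ω) => b k ⌊p.1 * k⌋₊ p.2) fun k => ?_
    have h1 : Measurable fun p : ℕ × Ω => b k p.1 p.2 :=
      measurable_from_prod_countable_right fun m => (hB.aemeasurable (q k m)).measurable_mk
    exact h1.comp (f := fun p : ℝ × Ω => (⌊p.1 * k⌋₊, p.2))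
      ((Nat.measurable_floor.comp (measurable_fst.mul_const _)).prodMk measurable_snd)
  · filter_upwards [hb, hB.cont] with ω h1 h2 s
    have hq : Tendsto (fun k : ℕ => q k ⌊(s : ℝ) * k⌋₊) atTop (𝓝 s) := by
      rw [← NNReal.tendsto_coe]
      simp only [q, NNReal.coe_div, NNReal.coe_natCast]
      exact (tendsto_nat_floor_mul_div_atTop s.coe_nonneg).comp tendsto_natCast_atTop_atTop
    have h3 := (h2.tendsto s).comp hq
    refine Tendsto.limsup_eq ?_
    simpa only [h1, Function.comp_def] using h3

/-- The inner norm is v^{a-1} v^{1/2} = v^{a-1/2}, integrable at 0 precisely because a > -1/2. -/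
theorem lintegral_eLpNorm_rpow_step_ne_top {a : ℝ} (ha : -1 / 2 < a) (s : ℝ≥0) :
    ∫⁻ v in Ioc (0 : ℝ) s,
      eLpNorm (fun u => if u ≤ v then v ^ (a - 1) else 0) 2 halfLine ≠ ∞ := by
  have hi := integrableOn_Ioc_rpow (a := a - 1 / 2) (by linarith) s
  refine ne_of_eq_of_ne (setLIntegral_congr_fun measurableSet_Ioc fun v hv => ?_) hi.2.ne
  have hv0 : 0 < v := hv.1
  have h : (v ^ (a - 1) • oneL2 v.toNNReal : Lp ℝ 2 halfLine) =ᵐ[halfLine]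
      fun u => if u ≤ v then v ^ (a - 1) else 0 := by
    filter_upwards [coeFn_smul_of_ae (v ^ (a - 1)) (coeFn_oneL2 v.toNNReal),
      ae_restrict_mem measurableSet_Ioi] with u hu hu0
    have hu0 : 0 < u := hu0
    rw [hu, Real.coe_toNNReal v hv0.le]
    simp [indicator, hu0]
  have hn : ‖oneL2 v.toNNReal‖ = v ^ (1 / 2 : ℝ) := by
    rw [norm_eq_sqrt_real_inner, inner_oneL2_oneL2, min_self, Real.coe_toNNReal v hv0.le,
      Real.sqrt_eq_rpow]
  simp only
  rw [← eLpNorm_congr_ae h, ← Lp.enorm_def, ← ofReal_norm, norm_smul, hn,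
    Real.norm_of_nonneg (by positivity), ← Real.rpow_add hv0, Real.enorm_of_nonneg (by positivity)]
  ring_nf

theorem mul_setIntegral_rpow_step {a u : ℝ} (s : ℝ) (hu : 0 < u) :
    a * ∫ v in Ioc (0 : ℝ) s, (if u ≤ v then v ^ (a - 1) else 0) =
      if u ≤ s then s ^ a - u ^ a else 0 := by
  split_ifs with hus
  · have h1 : ∫ v in Ioc (0 : ℝ) s, (if u ≤ v then v ^ (a - 1) else 0) =
        ∫ v in Ioc u s, v ^ (a - 1) := by
      rw [← integral_indicator measurableSet_Ioc, ← integral_indicator measurableSet_Ioc]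
      refine integral_congr_ae ?_
      have hne : ∀ᵐ v : ℝ, v ≠ u := by simp [ae_iff]
      filter_upwards [hne] with v hv
      simp only [indicator, mem_Ioc]
      grind
    rcases eq_or_ne a 0 with rfl | ha
    · simp
    · rw [h1, ← intervalIntegral.integral_of_le hus, integral_rpow, sub_add_cancel]
      · field_simp
      · refine Or.inr ⟨fun h => ha (by linarith), ?_⟩
        rw [uIcc_of_le hus]
        exact fun h => hu.not_ge h.1
  · rw [setIntegral_eq_zero_of_forall_eq_zero, mul_zero]
    intro v hv
    exact if_neg fun h => hus (h.trans hv.2)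

/-- Integration by parts for the Wiener integral of a power. -/
theorem rpow_mul_sub_ae_eq [SFinite P] {B' : ℝ → Ω → ℝ} (hB' : Measurable (Function.uncurry B'))
    {W : Lp ℝ 2 halfLine →ₗᵢ[ℝ] Lp ℝ 2 P} (hW : ∀ s : ℝ≥0, W (oneL2 s) =ᵐ[P] B' s)
    {a : ℝ} (ha : -1 / 2 < a) (s : ℝ≥0) :
    (fun ω => (s : ℝ) ^ a * B' s ω - a * ∫ v in Ioc (0 : ℝ) s, v ^ (a - 1) * B' v ω)
      =ᵐ[P] W (powL2 s ha) := by
  have hl : Measurable (Function.uncurry fun v u : ℝ => if u ≤ v then v ^ (a - 1) else 0) :=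
    Measurable.ite (measurableSet_le measurable_snd measurable_fst) (by fun_prop) measurable_const
  have hY : Measurable (Function.uncurry fun v ω => v ^ (a - 1) * B' v ω) :=
    Measurable.mul (f := fun p : ℝ × Ω => p.1 ^ (a - 1)) (by fun_prop) hB'
  have hfin := lintegral_eLpNorm_rpow_step_ne_top ha s
  have h := (isometry_integral_ae_eq (σ := volume.restrict (Ioc (0 : ℝ) s)) W hl hY
    (x := fun v => v ^ (a - 1) • oneL2 v.toNNReal) (by
      filter_upwards [ae_restrict_mem measurableSet_Ioc] with v hv
      filter_upwards [coeFn_smul_of_ae (v ^ (a - 1)) (coeFn_oneL2 v.toNNReal),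
        ae_restrict_mem measurableSet_Ioi] with u hu hu0
      have hu0 : 0 < u := hu0
      rw [hu, Real.coe_toNNReal v hv.1.le]
      simp [indicator, hu0]) (by
      filter_upwards [ae_restrict_mem measurableSet_Ioc] with v hv
      have h := hW v.toNNReal
      rw [Real.coe_toNNReal v hv.1.le] at h
      rw [map_smul]
      exact (coeFn_smul_of_ae _ h).symm) hfin).2
  set m := (memLp_integral_of_lintegral_eLpNorm hl hfin).toLp with hm
  -- On (0,s] this is u^a = s^a - a ∫_u^s v^{a-1} dv.
  have hpow : powL2 s ha = (s : ℝ) ^ a • oneL2 s - a • m := by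
    refine Lp.ext ?_
    refine (coeFn_trunc s _).trans (EventuallyEq.symm ?_)
    filter_upwards [coeFn_sub_of_ae (coeFn_smul_of_ae ((s : ℝ) ^ a) (coeFn_oneL2 s))
      (coeFn_smul_of_ae a (memLp_integral_of_lintegral_eLpNorm hl hfin).coeFn_toLp),
      ae_restrict_mem measurableSet_Ioi] with u hu hu0
    have hu0 : 0 < u := hu0
    rw [hu, mul_setIntegral_rpow_step s hu0]
    by_cases h : u ≤ s <;> simp [indicator, hu0, h]
  rw [hpow, map_sub, map_smul, map_smul]
  exact (coeFn_sub_of_ae (coeFn_smul_of_ae _ (hW s)) (coeFn_smul_of_ae _ h.symm)).symm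

theorem measurable_uncurry_rpow_mul_sub {B' : ℝ → Ω → ℝ} (hB' : Measurable (Function.uncurry B'))
    (a : ℝ) : Measurable (Function.uncurry fun (s : ℝ) (ω : Ω) =>
      s ^ a * B' s ω - a * ∫ v in Ioc (0 : ℝ) s, v ^ (a - 1) * B' v ω) := by
  have h1 : Measurable fun p : ℝ × Ω => p.1 ^ a * B' p.1 p.2 :=
    Measurable.mul (by fun_prop) hB'
  have h2 : Measurable fun p : ℝ × Ω => ∫ v in Ioc (0 : ℝ) p.1, v ^ (a - 1) * B' v p.2 := by
    have h3 : Measurable (Function.uncurry fun (p : ℝ × Ω) (v : ℝ) =>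
        (Ioc (0 : ℝ) p.1).indicator (fun v => v ^ (a - 1) * B' v p.2) v) := by
      have h4 : Measurable fun r : (ℝ × Ω) × ℝ => r.2 ^ (a - 1) * B' r.2 r.1.2 :=
        Measurable.mul (by fun_prop) (hB'.comp (f := fun r : (ℝ × Ω) × ℝ => (r.2, r.1.2))
          (by fun_prop))
      refine h4.indicator (s := {r : (ℝ × Ω) × ℝ | 0 < r.2 ∧ r.2 ≤ r.1.1}) ?_
      exact (measurableSet_lt measurable_const measurable_snd).inter
        (measurableSet_le measurable_snd (measurable_fst.comp measurable_fst))
    have h5 :=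
      (StronglyMeasurable.integral_prod_right (ν := volume) h3.stronglyMeasurable).measurable
    simpa only [integral_indicator measurableSet_Ioc] using h5
  exact h1.sub (h2.const_mul a)

/-! ### The transform of a Brownian motion -/

section Transform

variable {n : ℕ} {lam : Fin n → ℝ} {B T : ℝ≥0 → Ω → ℝ} {W : Lp ℝ 2 halfLine →ₗᵢ[ℝ] Lp ℝ 2 P}

theorem trunc_muntzKernel (hlam : ∀ j, -1 / 2 < lam j) (s : ℝ≥0) :
    trunc s (memL2_muntzKernel hlam s) = kernelL2 hlam s := by
  refine Lp.ext ((coeFn_trunc s _).trans (EventuallyEq.trans ?_ (coeFn_kernelL2 hlam s).symm))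
  filter_upwards [ae_restrict_mem measurableSet_Ioi] with v hv
  by_cases h : v ≤ s
  · rw [indicator_of_mem (show v ∈ Ioc (0 : ℝ) s from ⟨hv, h⟩)]
  · rw [indicator_of_notMem fun h' => h h'.2, muntzKernel, if_neg h]

theorem integral_kernel_ae_eq [SFinite P] (hinj : Function.Injective lam)
    (hlam : ∀ j, -1 / 2 < lam j) {Y : ℝ → Ω → ℝ} (hYm : Measurable (Function.uncurry Y))
    (hY : ∀ s : ℝ≥0, 0 < s → Y s =ᵐ[P] W (kernelL2 hlam s)) (t : ℝ≥0) :
    (∀ᵐ ω ∂P, IntegrableOn (fun s => Y s ω) (Ioc (0 : ℝ) t)) ∧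
      (fun ω => ∫ s in Ioc (0 : ℝ) t, Y s ω) =ᵐ[P] W (primitiveL2 hinj hlam t) := by
  refine isometry_integral_ae_eq W (measurable_uncurry_muntzKernel lam) hYm
    (ae_coeFn_kernelL2 hlam t) ?_ (lintegral_eLpNorm_muntzKernel_ne_top hinj hlam t)
  filter_upwards [ae_restrict_mem measurableSet_Ioc] with s hs
  have h := hY s.toNNReal (Real.toNNReal_pos.2 hs.1)
  rwa [Real.coe_toNNReal s hs.1.le] at h

theorem exists_isVolterraTransform (hB : IsBrownianReal B P)
    (hinj : Function.Injective lam) (hlam : ∀ j, -1 / 2 < lam j) :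
    ∃ T, IsVolterraTransform P B (muntzKernel lam) T := by
  have : IsProbabilityMeasure P := hB.isGaussianProcess.isProbabilityMeasure
  obtain ⟨W, hW⟩ := exists_wiener_isometry hB.toIsPreBrownianReal
  obtain ⟨B', hB'm, hB'⟩ := exists_measurable_version hB
  have hW' (s : ℝ≥0) : W (oneL2 s) =ᵐ[P] B' s := by
    filter_upwards [hW s, hB'] with ω h1 h2
    rw [h1, h2]
  -- The integral of k_n(s,·) is expanded in powers of v and each power is integrated by parts,
  -- which yields a version jointly measurable in (s,ω).
  let Y : ℝ → Ω → ℝ := fun s ω => ∑ j, muntzCoeff lam j * s ^ (-(lam j + 1)) *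
    (s ^ lam j * B' s ω - lam j * ∫ v in Ioc (0 : ℝ) s, v ^ (lam j - 1) * B' v ω)
  have hYm : Measurable (Function.uncurry Y) :=
    Finset.measurable_fun_sum _ fun j _ => Measurable.mul
      (f := fun p : ℝ × Ω => muntzCoeff lam j * p.1 ^ (-(lam j + 1))) (by fun_prop)
      (measurable_uncurry_rpow_mul_sub hB'm (lam j))
  have hY (s : ℝ≥0) : Y s =ᵐ[P] W (kernelL2 hlam s) := by
    rw [kernelL2, map_sum]
    refine (coeFn_finset_sum _ _ fun j _ => ?_).symm
    rw [map_smul]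
    exact coeFn_smul_of_ae _ (rpow_mul_sub_ae_eq hB'm hW' (hlam j) s).symm
  refine ⟨fun t ω => B t ω - ∫ s in (0 : ℝ)..t, Y s ω, Y, hYm, fun s _ => ?_, ?_⟩
  · rw [isWienerIntegral_iff hW (memL2_muntzKernel hlam s), trunc_muntzKernel]
    exact hY s
  · filter_upwards [ae_all_iff.2 fun k : ℕ =>
      (integral_kernel_ae_eq hinj hlam hYm (fun s _ => hY s) (k : ℝ≥0)).1] with ω hω t
    refine ⟨?_, rfl⟩
    obtain ⟨k, hk⟩ := exists_nat_ge t
    rw [intervalIntegrable_iff_integrableOn_Ioc_of_le t.coe_nonneg]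
    exact (hω k).mono_set (Ioc_subset_Ioc_right (by exact_mod_cast hk))

theorem IsVolterraTransform.ae_eq_isometry [SFinite P] (hW : ∀ s, W (oneL2 s) =ᵐ[P] B s)
    (hinj : Function.Injective lam) (hlam : ∀ j, -1 / 2 < lam j)
    (hT : IsVolterraTransform P B (muntzKernel lam) T) (t : ℝ≥0) :
    T t =ᵐ[P] W (transformL2 hinj hlam t) := by
  obtain ⟨Y, hYm, hY, hTY⟩ := hT
  have hY' (s : ℝ≥0) (hs : 0 < s) : Y s =ᵐ[P] W (kernelL2 hlam s) := by
    rw [← trunc_muntzKernel]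
    exact (isWienerIntegral_iff hW (memL2_muntzKernel hlam s)).1 (hY s hs)
  rw [transformL2, map_sub]
  refine EventuallyEq.trans ?_ (coeFn_sub_of_ae (hW t)
    (integral_kernel_ae_eq hinj hlam hYm hY' t).2.symm).symm
  filter_upwards [hTY] with ω hω
  rw [(hω t).2, intervalIntegral.integral_of_le t.coe_nonneg]

theorem IsVolterraTransform.isBrownianReal (hB : IsBrownianReal B P)
    (hinj : Function.Injective lam) (hlam : ∀ j, -1 / 2 < lam j)
    (hT : IsVolterraTransform P B (muntzKernel lam) T) : IsBrownianReal T P := by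
  have : IsProbabilityMeasure P := hB.isGaussianProcess.isProbabilityMeasure
  obtain ⟨W, hW⟩ := exists_wiener_isometry hB.toIsPreBrownianReal
  refine ⟨isPreBrownianReal_of_isometry hB.toIsPreBrownianReal hW
    (hT.ae_eq_isometry hW hinj hlam) fun s t hst => inner_transformL2 hinj hlam hst, ?_⟩
  obtain ⟨Y, -, -, hTY⟩ := hT
  filter_upwards [hTY, hB.cont] with ω hω hc
  have hfun : (T · ω) = fun t : ℝ≥0 => B t ω - ∫ s in (0 : ℝ)..t, Y s ω := funext fun t => (hω t).2
  rw [hfun]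
  refine hc.sub (continuous_iff_continuousAt.2 fun t => ?_)
  -- The horizon t+1 puts t in the relative interior, so continuity on the interval gives continuity
  -- at t.
  have h1 : ContinuousOn (fun x : ℝ => ∫ s in (0 : ℝ)..x, Y s ω) (Icc (0 : ℝ) (t + 1 : ℝ≥0)) := by
    have := intervalIntegral.continuousOn_primitive_interval' (hω (t + 1)).1 left_mem_uIcc
    rwa [uIcc_of_le (NNReal.coe_nonneg _)] at this
  have h2 : ContinuousOn (fun x : ℝ≥0 => ∫ s in (0 : ℝ)..x, Y s ω) (Iic (t + 1)) :=
    h1.comp NNReal.continuous_coe.continuousOn fun x hx => ⟨x.coe_nonneg, by exact_mod_cast hx⟩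
  exact h2.continuousAt (Iic_mem_nhds (lt_add_one t))

end Transform

end MuntzBM

theorem theorem2p1 {Ω : Type*} [MeasurableSpace Ω] (P : Measure Ω) [IsProbabilityMeasure P]
    (B : ℝ≥0 → Ω → ℝ) (hB : IsBrownianReal B P)
    (n : ℕ) (lam : Fin n → ℝ) (hinj : Function.Injective lam) (hlam : ∀ j, -1 / 2 < lam j) :
    MuntzBM.IsGoursatVolterraKernel P B n (MuntzBM.muntzKernel lam) ∧
    ∀ T : ℝ≥0 → Ω → ℝ, MuntzBM.IsVolterraTransform P B (MuntzBM.muntzKernel lam) T →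
      IsBrownianReal T P ∧
      (∀ t : ℝ≥0, MuntzBM.gaussianSpace P T t ≤ MuntzBM.gaussianSpace P B t ∧
        (MuntzBM.gaussianSpace P T t)ᗮ ⊓ MuntzBM.gaussianSpace P B t =
          MuntzBM.muntzGaussianSpace P B lam t) ∧
      MuntzBM.MemClassM (MuntzBM.muntzRho lam) ∧
      (∀ t : ℝ≥0, MuntzBM.IsWienerIntegral P B t
        (fun s => MuntzBM.muntzRho lam (t / s)) (T t)) := by
  obtain ⟨W, hW⟩ := MuntzBM.exists_wiener_isometry hB.toIsPreBrownianReal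
  refine ⟨⟨MuntzBM.isVolterraKernel_muntzKernel hinj hlam,
    MuntzBM.exists_isVolterraTransform hB hinj hlam, fun T hT => ?_⟩, fun T hT => ?_⟩
  · exact ⟨hT.isBrownianReal hB hinj hlam, fun j s => s ^ lam j,
      fun j t => MuntzBM.memL2_rpow t (hlam j), MuntzBM.linIndepAE_rpow hinj hlam,
      fun t _ => MuntzBM.isOrthogonalSum_transform hW hinj hlam
        (hT.ae_eq_isometry hW hinj hlam) t⟩
  · refine ⟨hT.isBrownianReal hB hinj hlam,
      MuntzBM.gaussianSpace_transform hW hinj hlam (hT.ae_eq_isometry hW hinj hlam),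
      MuntzBM.memClassM_muntzRho hinj hlam, fun t => ?_⟩
    rw [MuntzBM.isWienerIntegral_iff hW (MuntzBM.memL2_muntzRho hinj hlam t),
      MuntzBM.trunc_muntzRho]
    exact hT.ae_eq_isometry hW hinj hlam t
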